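/- Let $n\ge 1$ and let $M$ be a smooth $4n$-dimensional manifold with a quaternionic structure, that is, an $\mathrm{Sp}(1)\mathrm{GL}(n,\mathbb H)$-structure $Q$ (a smooth principal subbundle of the bundle of frames $\mathbb H^n\cong T_xM$ whose structure group is the group of maps $v\mapsto qvA$, $q\in\mathrm{Sp}(1)$, $A\in\mathrm{GL}(n,\mathbb H)$) which, if $n\ge 2$, admits a torsion-free connection. (For $n=1$ such a $Q$ is an oriented conformal structure, and no further condition is imposed; in particular self-dual conformal $4$-manifolds are included.) Through the frames in $Q$, the action of $\mathrm{Sp}(1)$ on $\mathbb H^n$ by left multiplication induces an action on $\Lambda^kT_x^*M\otimes\mathbb C$. For $r\in\mathbb Z$ let $E_{k,r}\subseteq\Lambda^kT^*M\otimes\mathbb C$ be the subbundle formed by the sum of all irreducible $\mathrm{Sp}(1)$-subrepresentations of highest weight $r$ (zero if there are none, e.g. if $r<0$); it does not depend on the choice of frames in $Q$. Then $\Lambda^kT^*M\otimes\mathbb C=\bigoplus_r E_{k,r}$. Let $\pi_{k,r}$ be the projection onto $E_{k,r}$, and on sections of $E_{k,r}$ define $$\mathcal D=\pi_{k+1,r+1}\circ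 d,\qquad \overline{\mathcal D}=\pi_{k+1,r-1}\circ d,$$ extended to all smooth complex-valued $k$-forms by linearity. Then $\mathcal D$ and $\overline{\mathcal D}$ are linear operators on smooth forms, which map real forms to real forms and satisfy $\mathcal D\,C^\infty(E_{k,r})\subseteq C^\infty(E_{k+1,r+1})$ and $\overline{\mathcal D}\,C^\infty(E_{k,r})\subseteq C^\infty(E_{k+1,r-1})$. On all smooth forms, $$d=\mathcal D+\overline{\mathcal D},\qquad \mathcal D^2=\mathcal D\overline{\mathcal D}+\overline{\mathcal D}\mathcal D=\overline{\mathcal D}^2=0 .$$ Thus the spaces $C^\infty(E_{k,r})$ with $\mathcal D$ and $\overline{\mathcal D}$ form a double complex. -/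

import Mathlib

open scoped Quaternion Manifold ContDiff Matrix

noncomputable section

namespace QuatDolbeault

/-! ### Exterior forms with complex values -/

/-- Complex-valued alternating `k`-forms on a real topological vector space: `Λᵏ V* ⊗ ℂ`. -/
abbrev AltForm (V : Type*) [AddCommGroup V] [Module ℝ V] [TopologicalSpace V] (k : ℕ) : Type _ :=
  V [⋀^Fin k]→L[ℝ] ℂ

/-- Pullback of `k`-forms along a linear map, as a `ℂ`-linear map. -/
def pullback {V W : Type*} [AddCommGroup V] [Module ℝ V] [TopologicalSpace V]
    [AddCommGroup W] [Module ℝ W] [TopologicalSpace W] (A : V →L[ℝ] W) (k : ℕ) :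
    AltForm W k →ₗ[ℂ] AltForm V k where
  toFun α := α.compContinuousLinearMap A
  map_add' _ _ := rfl
  map_smul' _ _ := rfl

/-! ### The model space `ℍⁿ` and the isotypic components of its exterior forms -/

/-- The space `ℍⁿ`. -/
abbrev HSpace (n : ℕ) : Type := Fin n → ℍ[ℝ]

/-- Left multiplication `v ↦ q v` on `ℍⁿ`. -/
def leftMul (n : ℕ) (q : ℍ[ℝ]) : HSpace n →L[ℝ] HSpace n :=
  ContinuousLinearMap.pi fun a =>
    (ContinuousLinearMap.mul ℝ ℍ[ℝ] q).comp (ContinuousLinearMap.proj a)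

theorem leftMul_apply (n : ℕ) (q : ℍ[ℝ]) (v : HSpace n) : leftMul n q v = fun a => q * v a := rfl

/-- The quaternion `i`. -/
def quatI : ℍ[ℝ] := ⟨0, 1, 0, 0⟩

/-- The quaternion `j`. -/
def quatJ : ℍ[ℝ] := ⟨0, 0, 1, 0⟩

/-- The quaternion `k`. -/
def quatK : ℍ[ℝ] := ⟨0, 0, 0, 1⟩

/-- The structures `I`, `J`, `K` on `ℍⁿ`: left multiplication by `i`, `j`, `k`. They satisfy
`I² = J² = K² = -1`, `IJ = K`, and span the Lie algebra `𝔰𝔭(1)` of the group `Sp(1)` of unit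
quaternions. -/
def modelI (n : ℕ) : HSpace n →L[ℝ] HSpace n := leftMul n quatI

/-- See `modelI`. -/
def modelJ (n : ℕ) : HSpace n →L[ℝ] HSpace n := leftMul n quatJ

/-- See `modelI`. -/
def modelK (n : ℕ) : HSpace n →L[ℝ] HSpace n := leftMul n quatK

/-- The action on `k`-forms induced by an endomorphism `A` of `V` (dual representation, extended by
the Leibniz rule): `(A·α)(v₁,…,vₖ) = - ∑ᵢ α(v₁,…,A vᵢ,…,vₖ)`. -/
def lieAct {V : Type*} [NormedAddCommGroup V] [NormedSpace ℝ V] (k : ℕ) (A : V →L[ℝ] V) :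
    AltForm V k →ₗ[ℂ] AltForm V k where
  toFun α := -(α.fderivCompContinuousLinearMap (ContinuousLinearMap.id ℝ V) A)
  map_add' α β := by
    ext v
    simp only [ContinuousAlternatingMap.neg_apply, ContinuousAlternatingMap.add_apply,
      ContinuousAlternatingMap.fderivCompContinuousLinearMap_apply, Finset.sum_add_distrib, neg_add]
  map_smul' c α := by
    ext v
    simp only [ContinuousAlternatingMap.neg_apply, ContinuousAlternatingMap.smul_apply,
      ContinuousAlternatingMap.fderivCompContinuousLinearMap_apply, RingHom.id_apply,
      Finset.smul_sum, smul_neg]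

theorem lieAct_apply {V : Type*} [NormedAddCommGroup V] [NormedSpace ℝ V] (k : ℕ)
    (A : V →L[ℝ] V) (α : AltForm V k) (v : Fin k → V) :
    lieAct k A α v = -∑ i, α (Function.update v i (A (v i))) := by
  simp only [lieAct, LinearMap.coe_mk, AddHom.coe_mk, ContinuousAlternatingMap.neg_apply,
    ContinuousAlternatingMap.fderivCompContinuousLinearMap_apply]
  congr 1
  refine Finset.sum_congr rfl fun i _ => congrArg α (funext fun j => ?_)
  by_cases h : j = i
  · subst h; simp
  · simp [h]

/-- A highest weight vector of weight `r` in `Λᵏ(ℍⁿ)* ⊗ ℂ`, for the Cartan subalgebra of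
`𝔰𝔩(2,ℂ) = 𝔰𝔭(1) ⊗ ℂ` spanned by `I`: the element `-iI` acts by `r` (so that the weights are
integers) and the raising operator `J - iK` acts by zero.
(Since `[I, J - iK] = 2i (J - iK)`, the latter raises weights by `2`.) -/
def IsHighestWeightVector (n k : ℕ) (r : ℤ) (α : AltForm (HSpace n) k) : Prop :=
  lieAct k (modelI n) α = (Complex.I * (r : ℂ)) • α ∧
    lieAct k (modelJ n) α - Complex.I • lieAct k (modelK n) α = 0

/-- A subspace is a subrepresentation for `Sp(1)` (equivalently for its Lie algebra `⟨I, J, K⟩`). -/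
def IsSubrep (n k : ℕ) (W : Submodule ℂ (AltForm (HSpace n) k)) : Prop :=
  ∀ α ∈ W, lieAct k (modelI n) α ∈ W ∧ lieAct k (modelJ n) α ∈ W ∧ lieAct k (modelK n) α ∈ W

/-- The part of `Λᵏ(ℍⁿ)* ⊗ ℂ` consisting of the `Sp(1)`-representations of highest weight `r`:
the subrepresentation generated by all highest weight vectors of weight `r`, that is, the sum of
all irreducible subrepresentations isomorphic to `V_r`. (It is zero if there are none, for
instance if `r < 0`.) -/
def modelE (n k : ℕ) (r : ℤ) : Submodule ℂ (AltForm (HSpace n) k) :=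
  sInf {W | IsSubrep n k W ∧ ∀ α, IsHighestWeightVector n k r α → α ∈ W}

/-! ### `Sp(1)GL(n,ℍ)`-structures on manifolds -/

/-- `g` belongs to the group `Sp(1)GL(n,ℍ)`: `g v = q v A` for a unit quaternion `q` and an
invertible quaternionic matrix `A`, elements of `ℍⁿ` being row vectors. -/
def MemSpGL (n : ℕ) (g : HSpace n ≃L[ℝ] HSpace n) : Prop :=
  ∃ (q : ℍ[ℝ]) (A : (Matrix (Fin n) (Fin n) ℍ[ℝ])ˣ), ‖q‖ = 1 ∧
    ∀ v, g v = leftMul n q (v ᵥ* (A : Matrix (Fin n) (Fin n) ℍ[ℝ]))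

/-- `T` belongs to the Lie algebra of `Sp(1)GL(n,ℍ)`: `T v = p v + v B` for an imaginary
quaternion `p` and a quaternionic matrix `B`. -/
def MemLieSpGL (n : ℕ) (T : HSpace n →L[ℝ] HSpace n) : Prop :=
  ∃ (p : ℍ[ℝ]) (B : Matrix (Fin n) (Fin n) ℍ[ℝ]), p.re = 0 ∧
    ∀ v, T v = leftMul n p v + v ᵥ* B

section Manifold

variable (n : ℕ) (M : Type*) [TopologicalSpace M]
  [ChartedSpace (EuclideanSpace ℝ (Fin (4 * n))) M]

/-- A (local) field of frames `s x : ℍⁿ ≃ T_x M` is smooth on `U`. -/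
def SmoothFrameOn {n : ℕ} {M : Type*} [TopologicalSpace M]
    [ChartedSpace (EuclideanSpace ℝ (Fin (4 * n))) M] [IsManifold (𝓡 (4 * n)) ∞ M]
    (s : ∀ x : M, HSpace n ≃L[ℝ] TangentSpace (𝓡 (4 * n)) x) (U : Set M) : Prop :=
  ∀ v : HSpace n, ContMDiffOn (𝓡 (4 * n)) (𝓡 (4 * n)).tangent ∞
    (fun x => (⟨x, s x v⟩ : TangentBundle (𝓡 (4 * n)) M)) U

/-- An `Sp(1)GL(n,ℍ)`-structure on a `4n`-manifold: a smooth principal subbundle `Q`, with this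
structure group, of the bundle of frames `ℍⁿ ≃ T_x M`. Each fibre is one orbit of the group, and
there are smooth local sections. -/
structure SpGLStructure [IsManifold (𝓡 (4 * n)) ∞ M] where
  /-- the fibre `Q_x` -/
  frames : ∀ x : M, Set (HSpace n ≃L[ℝ] TangentSpace (𝓡 (4 * n)) x)
  /-- each fibre is a single orbit of the structure group -/
  mem_frames_iff : ∀ x, ∀ u ∈ frames x, ∀ w, w ∈ frames x ↔ ∃ g, MemSpGL n g ∧ w = g.trans u
  /-- around every point there is a smooth local section -/
  exists_section : ∀ x₀ : M, ∃ U : Set M, IsOpen U ∧ x₀ ∈ U ∧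
    ∃ s : ∀ x : M, HSpace n ≃L[ℝ] TangentSpace (𝓡 (4 * n)) x,
      SmoothFrameOn s U ∧ ∀ x ∈ U, s x ∈ frames x

variable {n M}

/-- The linear connection `∇` on `TM` is (induced by) a connection on `Q`: in every smooth local
frame belonging to `Q`, the connection form takes values in the Lie algebra of the structure
group. -/
def SpGLStructure.IsCompatible [IsManifold (𝓡 (4 * n)) ∞ M] (Q : SpGLStructure n M)
    (cov : CovariantDerivative (𝓡 (4 * n)) (EuclideanSpace ℝ (Fin (4 * n)))
      (TangentSpace (𝓡 (4 * n)) : M → Type _)) : Prop :=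
  ∀ (U : Set M) (s : ∀ x : M, HSpace n ≃L[ℝ] TangentSpace (𝓡 (4 * n)) x), IsOpen U →
    SmoothFrameOn s U → (∀ x ∈ U, s x ∈ Q.frames x) →
      ∀ x ∈ U, ∀ X : TangentSpace (𝓡 (4 * n)) x, ∃ T : HSpace n →L[ℝ] HSpace n,
        MemLieSpGL n T ∧ ∀ v, cov (fun y => s y v) x X = s x (T v)

/-- `Q` admits a (smooth) torsion-free connection. -/
def SpGLStructure.AdmitsTorsionFreeConnection [IsManifold (𝓡 (4 * n)) ∞ M]
    (Q : SpGLStructure n M) : Prop :=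
  ∃ cov : CovariantDerivative (𝓡 (4 * n)) (EuclideanSpace ℝ (Fin (4 * n)))
      (TangentSpace (𝓡 (4 * n)) : M → Type _),
    CovariantDerivative.ContMDiffCovariantDerivative cov ∞ ∧ cov.torsion = 0 ∧ Q.IsCompatible cov

/-! ### Differential forms and the exterior derivative -/

variable (n M) in
/-- (Not necessarily smooth) complex-valued differential `k`-forms on `M`. -/
abbrev DForm (k : ℕ) : Type _ := ∀ x : M, AltForm (TangentSpace (𝓡 (4 * n)) x) k

/-- The expression of a form in the preferred chart `φ` at `x₀`, that is, the form `(φ⁻¹)^* η`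
(meaningful on the target of the chart). -/
def chartRep {k : ℕ} (η : DForm n M k) (x₀ : M) :
    EuclideanSpace ℝ (Fin (4 * n)) → AltForm (EuclideanSpace ℝ (Fin (4 * n))) k :=
  fun y => (η ((extChartAt (𝓡 (4 * n)) x₀).symm y)).compContinuousLinearMap
    (mfderiv 𝓘(ℝ, EuclideanSpace ℝ (Fin (4 * n))) (𝓡 (4 * n))
      (extChartAt (𝓡 (4 * n)) x₀).symm y)

/-- `η` is a smooth form. -/
def IsSmoothForm {k : ℕ} (η : DForm n M k) : Prop :=
  ∀ x₀ : M, ContDiffOn ℝ ∞ (chartRep η x₀) (extChartAt (𝓡 (4 * n)) x₀).target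

/-- `η` is real-valued. -/
def IsRealForm {k : ℕ} (η : DForm n M k) : Prop :=
  ∀ x v, (η x v).im = 0

/-- The exterior derivative, computed at `x` in the preferred chart `φ` at `x`:
`(dη)_x = φ^*(d((φ⁻¹)^* η))` at `x`. -/
def extD {k : ℕ} (η : DForm n M k) : DForm n M (k + 1) :=
  fun x => (extDeriv (chartRep η x) (extChartAt (𝓡 (4 * n)) x x)).compContinuousLinearMap
    (mfderiv (𝓡 (4 * n)) 𝓘(ℝ, EuclideanSpace ℝ (Fin (4 * n))) (extChartAt (𝓡 (4 * n)) x) x)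

/-! ### The bundles `E_{k,r}` and the operators `𝒟`, `𝒟̄` -/

variable [IsManifold (𝓡 (4 * n)) ∞ M] (Q : SpGLStructure n M)

/-- The fibre at `x` of `E_{k,r} ⊆ Λᵏ T^*M ⊗ ℂ`: the forms which a frame in `Q_x` identifies with
elements of `modelE n k r`. (The result is the same for every frame in `Q_x`.) -/
def SpGLStructure.E (k : ℕ) (r : ℤ) (x : M) :
    Submodule ℂ (AltForm (TangentSpace (𝓡 (4 * n)) x) k) :=
  ⨆ u ∈ Q.frames x,
    (modelE n k r).comap (pullback (u : HSpace n →L[ℝ] TangentSpace (𝓡 (4 * n)) x) k)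

/-- `C^∞(M, E_{k,r})`: `η` is a smooth section of `E_{k,r}`. -/
def SpGLStructure.IsSmoothSection (k : ℕ) (r : ℤ) (η : DForm n M k) : Prop :=
  IsSmoothForm η ∧ ∀ x, η x ∈ Q.E k r x

open Classical in
/-- The projection `π_{k,r}` of `Λᵏ T_x^*M ⊗ ℂ = ⨁ₛ E_{k,s}` onto `E_{k,r}`, along the sum of the
other summands. -/
def SpGLStructure.proj (k : ℕ) (r : ℤ) (x : M) :
    AltForm (TangentSpace (𝓡 (4 * n)) x) k →ₗ[ℂ] AltForm (TangentSpace (𝓡 (4 * n)) x) k :=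
  if h : IsCompl (Q.E k r x) (⨆ s ∈ {s : ℤ | s ≠ r}, Q.E k s x) then
    Submodule.projection _ _ h else 0

/-- `𝒟 = π_{k+1,r+1} ∘ d`, for sections of `E_{k,r}`. -/
def SpGLStructure.upper (k : ℕ) (r : ℤ) (η : DForm n M k) : DForm n M (k + 1) :=
  fun x => Q.proj (k + 1) (r + 1) x (extD η x)

/-- `𝒟̄ = π_{k+1,r-1} ∘ d`, for sections of `E_{k,r}`. -/
def SpGLStructure.lower (k : ℕ) (r : ℤ) (η : DForm n M k) : DForm n M (k + 1) :=
  fun x => Q.proj (k + 1) (r - 1) x (extD η x)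

/-- The operator `𝒟` on all `k`-forms: `𝒟 η = ∑_{r=0}^k 𝒟 (π_{k,r} η)`. -/
def SpGLStructure.D {k : ℕ} (η : DForm n M k) : DForm n M (k + 1) :=
  ∑ r ∈ Finset.range (k + 1), Q.upper k r fun x => Q.proj k r x (η x)

/-- The operator `𝒟̄` on all `k`-forms: `𝒟̄ η = ∑_{r=0}^k 𝒟̄ (π_{k,r} η)`. -/
def SpGLStructure.Dbar {k : ℕ} (η : DForm n M k) : DForm n M (k + 1) :=
  ∑ r ∈ Finset.range (k + 1), Q.lower k r fun x => Q.proj k r x (η x)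

end Manifold

end QuatDolbeault

end

noncomputable section

namespace QuatDolbeault

/-! Everything rests on one fact, `SpGLStructure.extD_mem`: `d` maps sections of `E_{k,r}` to
sections of `E_{k+1,r+1} ⊕ E_{k+1,r-1}`. Given this, `d = 𝒟 + 𝒟̄` holds on each component, and
splitting `d² = 0` into its parts of weights `r + 2`, `r`, `r - 2` gives the three identities.

For `n ≥ 2` take a torsion-free connection `∇` on `Q`. Then `dη` is the skew-symmetrization of `∇η`.
The connection form lies in the Lie algebra of the structure group, which preserves `E_{k,r}`, so
`∇η` takes values in `T* ⊗ E_{k,r}`. Complexified covectors are copies of the two-dimensional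
representation `V₁`, and the Clebsch–Gordan rule `V₁ ⊗ V_r = V_{r+1} ⊕ V_{r-1}` concludes. The local
computation is `pullback_extDeriv_mem`.

For `n = 1` no connection is needed: whenever `E_{k,r} ≠ 0`, the components of weights `r ± 1` are
all of `Λᵏ⁺¹` (`modelE_one_sup_eq_top`). The only point not settled by parity and Clebsch–Gordan is
that `Λ³` has weight `1` only.

The components are handled through the Casimir operator `I² + J² + K²`, which acts by `-r(r + 2)` on
weight `r`; `IsSpTriple.isotypic_eq_eigenspace` identifies component and eigenspace. Invariance of
the components then becomes commutation with the Casimir, and Clebsch–Gordan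
(`HomForm.alt_mem_modelE`) becomes a quadratic equation. -/

/-! ### Representations of `𝔰𝔭(1)` -/

/-- The commutation relations of the standard basis of `𝔰𝔭(1)`. -/
structure IsSpTriple {A : Type*} [Ring A] (I J K : A) : Prop where
  mul_IJ : I * J = J * I + (K + K)
  mul_JK : J * K = K * J + (I + I)
  mul_KI : K * I = I * K + (J + J)

/-- The Casimir element `I² + J² + K²`. -/
def casimir {A : Type*} [Ring A] (I J K : A) : A := I * I + J * J + K * K

theorem IsSpTriple.rotate {A : Type*} [Ring A] {I J K : A} (h : IsSpTriple I J K) :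
    IsSpTriple J K I := ⟨h.mul_JK, h.mul_KI, h.mul_IJ⟩

theorem casimir_rotate {A : Type*} [Ring A] (I J K : A) : casimir J K I = casimir I J K := by
  simp only [casimir]; abel

theorem IsSpTriple.commute_casimir {A : Type*} [Ring A] {I J K : A} (h : IsSpTriple I J K) :
    Commute (casimir I J K) I := by
  have e1 : J * J * I = I * (J * J) - (K * J + K * J) - (J * K + J * K) := by
    have h1 : J * I = I * J - (K + K) := by rw [h.mul_IJ]; abel
    rw [mul_assoc, h1, mul_sub, ← mul_assoc, h1]
    noncomm_ring
  have e2 : K * K * I = I * (K * K) + (J * K + J * K) + (K * J + K * J) := by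
    rw [mul_assoc, h.mul_KI, mul_add, ← mul_assoc, h.mul_KI]
    noncomm_ring
  rw [commute_iff_eq, casimir, add_mul, add_mul, e1, e2]
  noncomm_ring

attribute [local instance] LieRing.ofAssociativeRing

section Rep

variable {W : Type*} [AddCommGroup W] [Module ℂ W] {I J K : Module.End ℂ W}

open Complex (I_mul_I)

local notation "𝕚" => Complex.I

theorem IsSpTriple.raise_weight (h : IsSpTriple I J K) {α : W} {m : ℤ}
    (hα : I α = (𝕚 * (m : ℂ)) • α) :
    I (J α - 𝕚 • K α) = (𝕚 * ((m + 2 : ℤ) : ℂ)) • (J α - 𝕚 • K α) := by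
  have h1 : I (J α) = J (I α) + (K α + K α) := LinearMap.congr_fun h.mul_IJ α
  have h2 : K (I α) = I (K α) + (J α + J α) := LinearMap.congr_fun h.mul_KI α
  have h3 : I (K α) = K (I α) - (J α + J α) := by rw [h2]; abel
  rw [map_sub, map_smul, h1, h3, hα, map_smul, map_smul]
  push_cast
  match_scalars
  · ring_nf
  · linear_combination (2 : ℂ) * Complex.I_sq

theorem IsSpTriple.lower_weight (h : IsSpTriple I J K) {α : W} {m : ℤ}
    (hα : I α = (𝕚 * (m : ℂ)) • α) :
    I (J α + 𝕚 • K α) = (𝕚 * ((m - 2 : ℤ) : ℂ)) • (J α + 𝕚 • K α) := by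
  have h1 : I (J α) = J (I α) + (K α + K α) := LinearMap.congr_fun h.mul_IJ α
  have h2 : K (I α) = I (K α) + (J α + J α) := LinearMap.congr_fun h.mul_KI α
  have h3 : I (K α) = K (I α) - (J α + J α) := by rw [h2]; abel
  rw [map_add, map_smul, h1, h3, hα, map_smul, map_smul]
  push_cast
  match_scalars
  · ring_nf
  · linear_combination (2 : ℂ) * Complex.I_sq

/-- With `E = J - iK` and `F = J + iK` one has `FE = J² + K² - 2iI`, so the Casimir is `I² + 2iI +
FE`; now put `I = im`. -/
theorem IsSpTriple.casimir_eq_lower_raise (h : IsSpTriple I J K) {α : W} {m : ℤ}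
    (hα : I α = (𝕚 * (m : ℂ)) • α) :
    casimir I J K α = (-(m * (m + 2)) : ℂ) • α +
      (J (J α - 𝕚 • K α) + 𝕚 • K (J α - 𝕚 • K α)) := by
  have h1 : J (K α) = K (J α) + (I α + I α) := LinearMap.congr_fun h.mul_JK α
  simp only [casimir, LinearMap.add_apply, Module.End.mul_apply, map_sub, map_smul, h1, hα]
  match_scalars
  · linear_combination ((m : ℂ) ^ 2 + 2 * m) * Complex.I_sq
  · ring
  · linear_combination Complex.I_sq
  · ring

theorem IsSpTriple.casimir_eq_raise_lower (h : IsSpTriple I J K) {α : W} {m : ℤ}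
    (hα : I α = (𝕚 * (m : ℂ)) • α) :
    casimir I J K α = (-(m * (m - 2)) : ℂ) • α +
      (J (J α + 𝕚 • K α) - 𝕚 • K (J α + 𝕚 • K α)) := by
  have h1 : J (K α) = K (J α) + (I α + I α) := LinearMap.congr_fun h.mul_JK α
  simp only [casimir, LinearMap.add_apply, Module.End.mul_apply, map_add, map_smul, h1, hα]
  match_scalars
  · linear_combination ((m : ℂ) ^ 2 - 2 * m) * Complex.I_sq
  · ring
  · linear_combination Complex.I_sq
  · ring

/-- The factor `-1/4` normalizes `[e, f] = h`, because `[J - iK, J + iK] = 4iI`. -/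
theorem IsSpTriple.isSl2Triple (h : IsSpTriple I J K) (h0 : I ≠ 0) :
    IsSl2Triple (-𝕚 • I) (J - 𝕚 • K) (-(1 / 4 : ℂ) • (J + 𝕚 • K)) where
  h_ne_zero := by simpa using h0
  lie_e_f := by
    have h1 : J * K = K * J + (I + I) := h.mul_JK
    rw [Ring.lie_def]
    simp only [mul_sub, sub_mul, mul_add, add_mul, smul_mul_assoc, mul_smul_comm, h1]
    match_scalars
    · ring
    · ring
    · ring
    · ring_nf
  lie_h_e_nsmul := by
    have h2 := h.mul_KI
    have h1 := h.mul_IJ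
    rw [Ring.lie_def]
    simp only [mul_sub, sub_mul, smul_mul_assoc, mul_smul_comm, h1, h2]
    match_scalars
    · ring
    · ring
    · ring
    · linear_combination (-2 : ℂ) * Complex.I_sq
  lie_h_f_nsmul := by
    have h2 := h.mul_KI
    have h1 := h.mul_IJ
    rw [Ring.lie_def]
    simp only [mul_add, add_mul, smul_mul_assoc, mul_smul_comm, h1, h2]
    match_scalars
    · ring
    · ring
    · ring
    · linear_combination (-1 / 2 : ℂ) * Complex.I_sq

theorem IsSpTriple.commute_casimir_I (h : IsSpTriple I J K) (α : W) :
    casimir I J K (I α) = I (casimir I J K α) :=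
  LinearMap.congr_fun h.commute_casimir.eq α

theorem IsSpTriple.commute_casimir_J (h : IsSpTriple I J K) (α : W) :
    casimir I J K (J α) = J (casimir I J K α) := by
  rw [← casimir_rotate]; exact h.rotate.commute_casimir_I α

theorem IsSpTriple.commute_casimir_K (h : IsSpTriple I J K) (α : W) :
    casimir I J K (K α) = K (casimir I J K α) := by
  rw [← casimir_rotate, ← casimir_rotate]; exact h.rotate.rotate.commute_casimir_I α

theorem IsSpTriple.exists_weight_eq_natCast [FiniteDimensional ℂ W] (h : IsSpTriple I J K) {α : W}
    {m : ℤ} (hα : I α = (𝕚 * (m : ℂ)) • α) (h0 : α ≠ 0) (he : J α - 𝕚 • K α = 0) :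
    ∃ l : ℕ, m = l := by
  -- `IsSl2Triple` requires `h ≠ 0`; if `I = 0`, the only weight is `0`.
  by_cases hI : I = 0
  · refine ⟨0, ?_⟩
    rw [hI, LinearMap.zero_apply, eq_comm, smul_eq_zero_iff_left h0] at hα
    simpa using hα
  have P : (h.isSl2Triple hI).HasPrimitiveVectorWith α (m : ℂ) :=
    ⟨h0, by simp [hα, smul_smul, ← mul_assoc], by simpa using he⟩
  obtain ⟨l, hl⟩ := P.exists_nat
  exact ⟨l, by exact_mod_cast hl⟩

theorem IsSpTriple.exists_weight_eq_neg_natCast [FiniteDimensional ℂ W] (h : IsSpTriple I J K)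
    {α : W} {m : ℤ} (hα : I α = (𝕚 * (m : ℂ)) • α) (h0 : α ≠ 0) (hf : J α + 𝕚 • K α = 0) :
    ∃ l : ℕ, m = -l := by
  by_cases hI : I = 0
  · refine ⟨0, ?_⟩
    rw [hI, LinearMap.zero_apply, eq_comm, smul_eq_zero_iff_left h0] at hα
    simpa using hα
  have P : (h.isSl2Triple hI).symm.HasPrimitiveVectorWith α ((-m : ℤ) : ℂ) := by
    refine ⟨h0, by simp [hα, smul_smul, ← mul_assoc], ?_⟩
    simpa [← smul_add] using hf
  obtain ⟨l, hl⟩ := P.exists_nat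
  exact ⟨l, by rw [← neg_eq_iff_eq_neg]; exact_mod_cast hl⟩

/-- An operator which shifts the weight by a nonzero amount is nilpotent on weight vectors. -/
theorem exists_pow_apply_eq_zero [FiniteDimensional ℂ W] {E : Module.End ℂ W} {s : ℤ} (hs : s ≠ 0)
    (hE : ∀ (α : W) (m : ℤ), I α = (𝕚 * (m : ℂ)) • α → I (E α) = (𝕚 * ((m + s : ℤ) : ℂ)) • E α)
    {α : W} {m : ℤ} (hα : I α = (𝕚 * (m : ℂ)) • α) : ∃ j : ℕ, (E ^ j) α = 0 := by
  by_contra! hne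
  have hw (j : ℕ) : I ((E ^ j) α) = (𝕚 * ((m + j * s : ℤ) : ℂ)) • (E ^ j) α := by
    induction j with
    | zero => simpa using hα
    | succ j ih =>
      rw [pow_succ', Module.End.mul_apply, hE _ _ ih]
      push_cast
      ring_nf
  -- Nonzero iterates would be eigenvectors for distinct eigenvalues, an infinite independent
  -- family.
  have hli := I.eigenvectors_linearIndependent' (fun j : ℕ => 𝕚 * ((m + j * s : ℤ) : ℂ))
    (fun j j' hj => by simpa [hs] using hj) (fun j => (E ^ j) α)
    (fun j => ⟨Module.End.mem_eigenspace_iff.mpr (hw j), hne j⟩)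
  exact not_finite_iff_infinite.mpr inferInstance hli.finite

/-- Weights of vectors on which the Casimir operator acts as on the representation of highest
weight `r` are at least `-r`. -/
theorem IsSpTriple.neg_le_weight [FiniteDimensional ℂ W] (h : IsSpTriple I J K) {r : ℤ}
    (hr : 0 ≤ r) {α : W} {m : ℤ} (hα : I α = (𝕚 * (m : ℂ)) • α)
    (hc : casimir I J K α = (-(r * (r + 2)) : ℂ) • α) (h0 : α ≠ 0) : -r ≤ m := by
  obtain ⟨j, hj⟩ := exists_pow_apply_eq_zero (E := J + 𝕚 • K) (s := -2) (by norm_num)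
    (fun α m hα => h.lower_weight hα) hα
  induction j generalizing α m with
  | zero => exact absurd hj h0
  | succ j ih =>
    -- A lowest weight vector has weight `-l`, and the Casimir value forces `l = r`. Otherwise lower
    -- once more, which only decreases the weight.
    by_cases hF : J α + 𝕚 • K α = 0
    · obtain ⟨l, rfl⟩ := h.exists_weight_eq_neg_natCast hα h0 hF
      have h1 := h.casimir_eq_raise_lower hα
      rw [hF, map_zero, map_zero, smul_zero, sub_zero, add_zero, hc] at h1
      have h2 := smul_left_injective ℂ h0 h1
      have h3 : r * (r + 2) = l * (l + 2) := by
        have : (r * (r + 2) : ℂ) = l * (l + 2) := by push_cast at h2; linear_combination -h2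
        exact_mod_cast this
      nlinarith
    · have := ih (h.lower_weight hα) ?_ hF ?_
      · linarith
      · rw [map_add, map_smul, h.commute_casimir_J, h.commute_casimir_K, hc, map_smul, map_smul,
          smul_add, smul_comm]
      · rw [pow_succ, Module.End.mul_apply] at hj
        simpa using hj

/-- The subrepresentation generated by the highest weight vectors of weight `r`. -/
def isotypic (I J K : Module.End ℂ W) (r : ℤ) : Submodule ℂ W :=
  sInf {U | (∀ α ∈ U, I α ∈ U ∧ J α ∈ U ∧ K α ∈ U) ∧
    ∀ α, (I α = (𝕚 * (r : ℂ)) • α ∧ J α - 𝕚 • K α = 0) → α ∈ U}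

theorem mem_isotypic_of_highestWeight {r : ℤ} {α : W} (hα : I α = (𝕚 * (r : ℂ)) • α)
    (he : J α - 𝕚 • K α = 0) : α ∈ isotypic I J K r :=
  Submodule.mem_sInf.mpr fun _ hU => hU.2 α ⟨hα, he⟩

theorem isotypic_le {r : ℤ} {U : Submodule ℂ W} (hU : ∀ α ∈ U, I α ∈ U ∧ J α ∈ U ∧ K α ∈ U)
    (hw : ∀ α, I α = (𝕚 * (r : ℂ)) • α → J α - 𝕚 • K α = 0 → α ∈ U) : isotypic I J K r ≤ U :=
  sInf_le ⟨hU, fun α hα => hw α hα.1 hα.2⟩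

theorem isotypic_invariant {r : ℤ} {α : W} (hα : α ∈ isotypic I J K r) :
    I α ∈ isotypic I J K r ∧ J α ∈ isotypic I J K r ∧ K α ∈ isotypic I J K r := by
  simp only [isotypic, Submodule.mem_sInf] at hα ⊢
  exact ⟨fun U hU => (hU.1 α (hα U hU)).1, fun U hU => (hU.1 α (hα U hU)).2.1,
    fun U hU => (hU.1 α (hα U hU)).2.2⟩

theorem IsSpTriple.isotypic_le_eigenspace (h : IsSpTriple I J K) (r : ℤ) :
    isotypic I J K r ≤ (casimir I J K).eigenspace (-(r * (r + 2)) : ℂ) := by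
  refine isotypic_le (fun α hα => ?_) fun α hα he => ?_
  · simp only [Module.End.mem_eigenspace_iff] at hα ⊢
    rw [h.commute_casimir_I, h.commute_casimir_J, h.commute_casimir_K, hα]
    simp
  · rw [Module.End.mem_eigenspace_iff, h.casimir_eq_lower_raise hα, he]
    simp

theorem IsSpTriple.isotypic_of_neg [FiniteDimensional ℂ W] (h : IsSpTriple I J K) {r : ℤ}
    (hr : r < 0) : isotypic I J K r = ⊥ := by
  rw [eq_bot_iff]
  refine isotypic_le (fun α hα => ?_) fun α hα he => ?_
  · simp [(Submodule.mem_bot ℂ).mp hα]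
  · by_contra h0
    obtain ⟨l, rfl⟩ := h.exists_weight_eq_natCast hα h0 he
    lia

/-- Induction on the number of raisings that kill `α`. Since `FEα` is a multiple of `α`, membership
of `Eα` gives membership of `α` as soon as this multiple is nonzero. -/
theorem IsSpTriple.mem_isotypic_of_weight [FiniteDimensional ℂ W] (h : IsSpTriple I J K) {r : ℤ}
    (hr : 0 ≤ r) {α : W} {m : ℤ} (hα : I α = (𝕚 * (m : ℂ)) • α)
    (hc : casimir I J K α = (-(r * (r + 2)) : ℂ) • α) : α ∈ isotypic I J K r := by
  obtain ⟨j, hj⟩ := exists_pow_apply_eq_zero (E := J - 𝕚 • K) (s := 2) (by norm_num)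
    (fun α m hα => h.raise_weight hα) hα
  induction j generalizing α m with
  | zero => rw [show α = 0 from hj]; exact zero_mem _
  | succ j ih =>
    by_cases h0 : α = 0
    · rw [h0]; exact zero_mem _
    have h1 := h.casimir_eq_lower_raise hα
    by_cases hE : J α - 𝕚 • K α = 0
    · obtain ⟨l, rfl⟩ := h.exists_weight_eq_natCast hα h0 hE
      rw [hE, map_zero, map_zero, smul_zero, add_zero, add_zero, hc] at h1
      have h2 := smul_left_injective ℂ h0 h1
      have h3 : r * (r + 2) = l * (l + 2) := by
        have : (r * (r + 2) : ℂ) = l * (l + 2) := by push_cast at h2; linear_combination -h2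
        exact_mod_cast this
      obtain rfl : r = l := by nlinarith
      exact mem_isotypic_of_highestWeight hα hE
    · have hcE : casimir I J K (J α - 𝕚 • K α) = (-(r * (r + 2)) : ℂ) • (J α - 𝕚 • K α) := by
        rw [map_sub, map_smul, h.commute_casimir_J, h.commute_casimir_K, hc, map_smul, map_smul,
          smul_sub, smul_comm]
      have h2 := ih (h.raise_weight hα) hcE
        (by rw [pow_succ, Module.End.mul_apply] at hj; simpa using hj)
      have h3 : ((m * (m + 2) : ℂ) - r * (r + 2)) • α ∈ isotypic I J K r := by
        have h4 := isotypic_invariant h2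
        have h5 := add_mem h4.2.1 (Submodule.smul_mem _ 𝕚 h4.2.2)
        convert h5 using 1
        rw [sub_smul, ← sub_eq_iff_eq_add'.mpr h1, hc]
        module
      by_cases hm : (m * (m + 2) : ℂ) - r * (r + 2) = 0
      -- The roots of `m(m + 2) = r(r + 2)` are `r` and `-r - 2`, and `neg_le_weight` excludes the
      -- second. If `m = r`, then `Eα ≠ 0` would be a lowest weight vector of positive weight `r +
      -- 2`.
      · exfalso
        have hm' : m * (m + 2) = r * (r + 2) := by
          have := sub_eq_zero.mp hm
          exact_mod_cast this
        have hmr : -r ≤ m := h.neg_le_weight hr hα hc h0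
        have hmr' : m = r := by nlinarith
        subst hmr'
        rw [hc, left_eq_add] at h1
        have h6 := h.casimir_eq_raise_lower (h.raise_weight hα)
        rw [h1, map_zero, map_zero, smul_zero, sub_zero, add_zero, hcE] at h6
        obtain ⟨l, hl⟩ := h.exists_weight_eq_neg_natCast (h.raise_weight hα) hE h1
        lia
      · exact (Submodule.smul_mem_iff _ hm).mp h3

/-- The Casimir eigenspace is stable under the diagonalizable operator `I`, hence spanned by weight
vectors, to which `mem_isotypic_of_weight` applies. -/
theorem IsSpTriple.isotypic_eq_eigenspace [FiniteDimensional ℂ W] (h : IsSpTriple I J K)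
    (hI : ⨆ m : ℤ, I.eigenspace (𝕚 * (m : ℂ)) = ⊤) {r : ℤ} (hr : 0 ≤ r) :
    isotypic I J K r = (casimir I J K).eigenspace (-(r * (r + 2)) : ℂ) := by
  refine le_antisymm (h.isotypic_le_eigenspace r) fun α hα => ?_
  set p := (casimir I J K).eigenspace (-(r * (r + 2)) : ℂ) with hp
  have hinv : ∀ α ∈ p, I α ∈ p := fun α hα => by
    rw [hp, Module.End.mem_eigenspace_iff] at hα ⊢
    rw [h.commute_casimir_I, hα, map_smul]
  have htop : ⨆ μ : ℂ, I.eigenspace μ = ⊤ :=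
    top_le_iff.mp (hI ▸ iSup_le fun m => le_iSup I.eigenspace (𝕚 * (m : ℂ)))
  have h1 := Submodule.inf_iSup_genEigenspace hinv 1
  have h2 : α ∈ ⨆ μ, p ⊓ I.eigenspace μ := by
    rw [show (⨆ μ, p ⊓ I.eigenspace μ) = p ⊓ ⨆ μ, I.eigenspace μ from h1.symm, htop]
    exact ⟨hα, trivial⟩
  refine (iSup_le fun μ => ?_ : ⨆ μ, p ⊓ I.eigenspace μ ≤ isotypic I J K r) h2
  by_cases hμ : ∃ m : ℤ, μ = 𝕚 * m
  · obtain ⟨m, rfl⟩ := hμ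
    exact fun β hβ => h.mem_isotypic_of_weight hr (Module.End.mem_eigenspace_iff.mp hβ.2)
      (Module.End.mem_eigenspace_iff.mp hβ.1)
  -- An eigenspace for any other eigenvalue is independent of those of integer weight, which already
  -- span, so it is zero.
  · have hd : Disjoint (I.eigenspace μ) (⨆ ν ≠ μ, I.eigenspace ν) := I.eigenspaces_iSupIndep μ
    have hle : (⊤ : Submodule ℂ W) ≤ ⨆ ν ≠ μ, I.eigenspace ν := by
      rw [← hI]
      exact iSup_le fun m => le_iSup₂_of_le (𝕚 * (m : ℂ)) (fun hm => hμ ⟨m, hm.symm⟩) le_rfl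
    rw [top_le_iff.mp hle, disjoint_top] at hd
    rw [hd, inf_bot_eq]
    exact bot_le

/-- The sum of the trivial subrepresentations consists of the invariant vectors. -/
theorem IsSpTriple.invariant_of_mem_isotypic_zero [FiniteDimensional ℂ W] (h : IsSpTriple I J K)
    {α : W} (hα : α ∈ isotypic I J K 0) : I α = 0 ∧ J α = 0 ∧ K α = 0 := by
  suffices isotypic I J K 0 ≤ LinearMap.ker I ⊓ LinearMap.ker J ⊓ LinearMap.ker K by
    obtain ⟨⟨h1, h2⟩, h3⟩ := this hα
    exact ⟨h1, h2, h3⟩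
  refine isotypic_le (fun α hα => ?_) fun α hα he => ?_
  · obtain ⟨⟨h1, h2⟩, h3⟩ := hα
    rw [LinearMap.mem_ker.mp h1, LinearMap.mem_ker.mp h2, LinearMap.mem_ker.mp h3]
    exact ⟨zero_mem _, zero_mem _, zero_mem _⟩
  -- A nonzero `Fα` would have weight `-2` and Casimir value `0`, against `neg_le_weight` for `r =
  -- 0`.
  · have hf : J α + 𝕚 • K α = 0 := by
      by_contra hne
      have h1 := h.casimir_eq_lower_raise hα
      rw [h.casimir_eq_raise_lower hα, he] at h1
      by_cases h0 : α = 0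
      · simp [h0] at hne
      have hc : casimir I J K (J α + 𝕚 • K α) = (-((0 : ℤ) * ((0 : ℤ) + 2)) : ℂ) •
          (J α + 𝕚 • K α) := by
        have hcα : casimir I J K α = 0 := by rw [h.casimir_eq_lower_raise hα, he]; simp
        rw [map_add, map_smul, h.commute_casimir_J, h.commute_casimir_K, hcα]; simp
      have := h.neg_le_weight le_rfl (h.lower_weight hα) hc hne
      lia
    have hJ : (2 : ℂ) • J α = 0 := by
      rw [show (2 : ℂ) • J α = (J α - 𝕚 • K α) + (J α + 𝕚 • K α) by module, he, hf, add_zero]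
    have hJ' : J α = 0 := (smul_eq_zero_iff_right two_ne_zero).mp hJ
    rw [hJ', zero_add, smul_eq_zero_iff_right Complex.I_ne_zero] at hf
    exact ⟨⟨by simpa using hα, hJ'⟩, hf⟩

end Rep

/-! ### The action of endomorphisms on exterior forms -/

section LieAct

variable {V V' : Type*} [NormedAddCommGroup V] [NormedSpace ℝ V]
  [NormedAddCommGroup V'] [NormedSpace ℝ V']

instance finiteDimensional_altForm [FiniteDimensional ℝ V] (k : ℕ) :
    FiniteDimensional ℂ (AltForm V k) := by
  let f : AltForm V k →ₗ[ℝ] MultilinearMap ℝ (fun _ : Fin k => V) ℂ :=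
    { toFun := fun α => α.toMultilinearMap
      map_add' := fun _ _ => rfl
      map_smul' := fun _ _ => rfl }
  have hf : Function.Injective f := fun α β h => by
    ext v
    exact congrArg (fun m : MultilinearMap ℝ (fun _ : Fin k => V) ℂ => m v) h
  have : FiniteDimensional ℝ (AltForm V k) := FiniteDimensional.of_injective f hf
  exact FiniteDimensional.right ℝ ℂ _

theorem lieAct_add (k : ℕ) (A B : V →L[ℝ] V) (α : AltForm V k) :
    lieAct k (A + B) α = lieAct k A α + lieAct k B α := by
  simp only [lieAct, LinearMap.coe_mk, AddHom.coe_mk, map_add, neg_add]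

theorem lieAct_smul (k : ℕ) (c : ℝ) (A : V →L[ℝ] V) (α : AltForm V k) :
    lieAct k (c • A) α = (c : ℂ) • lieAct k A α := by
  ext v
  simp [lieAct]

/-- Terms in which `A` and `B` act in different slots are symmetric in the two, so only the terms
with both in one slot enter the commutator. The sign in `lieAct` makes the action a homomorphism. -/
theorem lieAct_comm (k : ℕ) (A B : V →L[ℝ] V) (α : AltForm V k) :
    lieAct k A (lieAct k B α) = lieAct k B (lieAct k A α) + lieAct k (A * B - B * A) α := by
  classical
  have key (A B : V →L[ℝ] V) (v : Fin k → V) : lieAct k A (lieAct k B α) v =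
      ∑ i, (α (Function.update v i (B (A (v i)))) + ∑ j ∈ Finset.univ.erase i,
        α (Function.update (Function.update v i (A (v i))) j (B (v j)))) := by
    simp only [lieAct_apply, Finset.sum_neg_distrib, neg_neg]
    refine Finset.sum_congr rfl fun i _ => ?_
    rw [← Finset.add_sum_erase _ _ (Finset.mem_univ i)]
    congr 1
    · simp
    · refine Finset.sum_congr rfl fun j hj => ?_
      rw [Function.update_of_ne (Finset.ne_of_mem_erase hj)]
  ext v
  rw [ContinuousAlternatingMap.add_apply, key, key, lieAct_apply]
  simp only [Finset.sum_add_distrib]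
  have h1 : ∑ i, α (Function.update v i (B (A (v i)))) =
      ∑ i, α (Function.update v i (A (B (v i)))) +
      -∑ i, α (Function.update v i ((A * B - B * A) (v i))) := by
    rw [← sub_eq_add_neg, ← Finset.sum_sub_distrib]
    refine Finset.sum_congr rfl fun i _ => ?_
    rw [_root_.sub_apply, ContinuousAlternatingMap.map_update_sub]
    simp
  rw [h1, add_right_comm]
  congr 2
  · rw [Finset.sum_sigma', Finset.sum_sigma']
    refine Finset.sum_nbij' (fun p => ⟨p.2, p.1⟩) (fun p => ⟨p.2, p.1⟩) ?_ ?_ ?_ ?_ ?_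
    · simp +contextual [eq_comm]
    · simp +contextual [eq_comm]
    · simp
    · simp
    · rintro ⟨i, j⟩ hij
      have hne : j ≠ i := by simpa using hij
      dsimp only
      rw [Function.update_comm hne.symm]

theorem pullback_apply (g : V' →L[ℝ] V) (k : ℕ) (α : AltForm V k) (v : Fin k → V') :
    pullback g k α v = α (fun i => g (v i)) := rfl

theorem pullback_lieAct (k : ℕ) {A : V →L[ℝ] V} {B : V' →L[ℝ] V'} {g : V' →L[ℝ] V}
    (h : ∀ v, A (g v) = g (B v)) (α : AltForm V k) :
    pullback g k (lieAct k A α) = lieAct k B (pullback g k α) := by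
  ext v
  simp only [pullback_apply, lieAct_apply]
  congr 1
  refine Finset.sum_congr rfl fun i _ => congrArg α (funext fun j => ?_)
  by_cases hj : j = i
  · subst hj; simp [h]
  · simp [hj]

-- Equivariance of skew-symmetrization `V* ⊗ Λᵏ V* → Λᵏ⁺¹ V*`: here `γ` is the result of letting `A`
-- act on `β` in the tensor product.
open ContinuousAlternatingMap in
theorem lieAct_alternatizeUncurryFin (k : ℕ) (A : V →L[ℝ] V) {β γ : V →L[ℝ] AltForm V k}
    (h : ∀ v, γ v = lieAct k A (β v) - β (A v)) :
    lieAct (k + 1) A (alternatizeUncurryFin β) = alternatizeUncurryFin γ := by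
  ext v
  simp only [lieAct_apply, alternatizeUncurryFin_apply]
  rw [Finset.sum_comm, ← Finset.sum_neg_distrib]
  refine Finset.sum_congr rfl fun i _ => ?_
  rw [Fin.sum_univ_succAbove _ i, h, ContinuousAlternatingMap.sub_apply, lieAct_apply]
  simp only [Function.update_self, Fin.removeNth_update, ← Finset.smul_sum]
  have h2 : ∀ j : Fin k, β (Function.update v (i.succAbove j) (A (v (i.succAbove j))) i)
      (i.removeNth (Function.update v (i.succAbove j) (A (v (i.succAbove j))))) =
      β (v i) (Function.update (i.removeNth v) j (A (i.removeNth v j))) := fun j => by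
    rw [Function.update_of_ne (Fin.succAbove_ne i j).symm]
    congr 1
    ext l
    simp only [Fin.removeNth]
    by_cases hl : l = j
    · subst hl; simp
    · simp [hl, Fin.removeNth]
  simp only [h2, ← smul_add, ← smul_neg]
  congr 1
  abel

open ContinuousAlternatingMap in
/-- If a submodule of `Λᵏ⁺¹` contains all products of covectors with elements of subspaces spanning
`Λᵏ`, it is everything. -/
theorem eq_top_of_alternatize_mem [FiniteDimensional ℝ V] {k : ℕ} {ι : Sort*}
    {S : ι → Submodule ℂ (AltForm V k)}
    (hS : ⨆ i, S i = ⊤) {U : Submodule ℂ (AltForm V (k + 1))}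
    (hU : ∀ i, ∀ β : V →L[ℝ] AltForm V k, (∀ v, β v ∈ S i) → alternatizeUncurryFin β ∈ U) :
    U = ⊤ := by
  rw [eq_top_iff]
  rintro α -
  let b := Module.finBasis ℝ V
  let L (f : V →L[ℝ] ℝ) : AltForm V k →ₗ[ℂ] AltForm V (k + 1) :=
    { toFun := fun w => alternatizeUncurryFin (f.smulRight w)
      map_add' := fun w w' => by
        rw [← alternatizeUncurryFin_add]; congr 1; ext; simp
      map_smul' := fun c w => by
        rw [RingHom.id_apply, ← alternatizeUncurryFin_smul]; congr 1; ext; simp; ring }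
  have hL (f : V →L[ℝ] ℝ) : U.comap (L f) = ⊤ := by
    rw [eq_top_iff, ← hS]
    exact iSup_le fun i w hw => hU i _ fun v => by
      simpa using Submodule.smul_mem _ ((f v : ℝ) : ℂ) hw
  have hβ (β : V →L[ℝ] AltForm V k) :
      alternatizeUncurryFin β = ∑ j, L (b.coord j).toContinuousLinearMap (β (b j)) := by
    have : β = ∑ j, (b.coord j).toContinuousLinearMap.smulRight (β (b j)) := by
      ext1 v
      conv_lhs => rw [← b.sum_repr v]
      simp [_root_.map_sum, -Module.Basis.sum_repr]
    conv_lhs => rw [this]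
    simp only [← alternatizeUncurryFinCLM_apply, _root_.map_sum]
    rfl
  have h1 : alternatizeUncurryFin (curryLeft α) ∈ U := by
    rw [hβ]
    exact Submodule.sum_mem _ fun j _ => by
      have : (curryLeft α) (b j) ∈ U.comap (L (b.coord j).toContinuousLinearMap) := by
        rw [hL]; trivial
      exact this
  -- Currying and skew-symmetrizing multiplies `α` by `k + 1`, which can be divided out.
  rw [alternatizeUncurryFin_curryLeft, ← Nat.cast_smul_eq_nsmul ℂ] at h1
  exact (Submodule.smul_mem_iff _ (by exact_mod_cast Nat.succ_ne_zero k)).mp h1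

end LieAct

/-! ### Tensor products with a quaternionic representation -/

/-- The multiplication table of the quaternion units. -/
structure IsQuatTriple {A : Type*} [Ring A] (I J K : A) : Prop where
  mul_II : I * I = -1
  mul_JJ : J * J = -1
  mul_KK : K * K = -1
  mul_IJ : I * J = K
  mul_JK : J * K = I
  mul_KI : K * I = J
  mul_JI : J * I = -K
  mul_KJ : K * J = -I
  mul_IK : I * K = -J

section Tensor

variable {A : Type*} [Ring A] {P₁ P₂ P₃ R₁ R₂ R₃ : A}

theorem casimir_add_quat (hR : IsQuatTriple R₁ R₂ R₃)
    (h11 : Commute P₁ R₁) (h22 : Commute P₂ R₂) (h33 : Commute P₃ R₃) :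
    casimir (P₁ + R₁) (P₂ + R₂) (P₃ + R₃) =
      casimir P₁ P₂ P₃ - (1 + 1 + 1) + ((P₁ * R₁ + P₂ * R₂ + P₃ * R₃) +
        (P₁ * R₁ + P₂ * R₂ + P₃ * R₃)) := by
  simp only [casimir, mul_add, add_mul, hR.mul_II, hR.mul_JJ, hR.mul_KK, ← h11.eq, ← h22.eq,
    ← h33.eq]
  abel

/-- For the coupling `T = ∑ PᵢRᵢ`, off-diagonal products pair up to commutators of the `Pᵢ` and give
`2T`; diagonal ones give minus the Casimir. When the Casimir is `-r(r + 2)` this says `(T + r)(T -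
(r + 2)) = 0`, which is Clebsch–Gordan for `V_r ⊗ V₁`. -/
theorem IsSpTriple.sq_coupling (hP : IsSpTriple P₁ P₂ P₃) (hR : IsQuatTriple R₁ R₂ R₃)
    (h11 : Commute R₁ P₁) (h12 : Commute R₁ P₂) (h13 : Commute R₁ P₃)
    (h21 : Commute R₂ P₁) (h22 : Commute R₂ P₂) (h23 : Commute R₂ P₃)
    (h31 : Commute R₃ P₁) (h32 : Commute R₃ P₂) (h33 : Commute R₃ P₃) :
    (P₁ * R₁ + P₂ * R₂ + P₃ * R₃) * (P₁ * R₁ + P₂ * R₂ + P₃ * R₃) =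
      -casimir P₁ P₂ P₃ + ((P₁ * R₁ + P₂ * R₂ + P₃ * R₃) + (P₁ * R₁ + P₂ * R₂ + P₃ * R₃)) := by
  simp only [casimir, mul_add, add_mul, h11.mul_mul_mul_comm, h12.mul_mul_mul_comm,
    h13.mul_mul_mul_comm, h21.mul_mul_mul_comm, h22.mul_mul_mul_comm, h23.mul_mul_mul_comm,
    h31.mul_mul_mul_comm, h32.mul_mul_mul_comm, h33.mul_mul_mul_comm, hR.mul_II, hR.mul_JJ,
    hR.mul_KK, hR.mul_IJ, hR.mul_JK, hR.mul_KI, hR.mul_JI, hR.mul_KJ, hR.mul_IK, hP.mul_IJ,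
    hP.mul_JK, hP.mul_KI]
  noncomm_ring

end Tensor

/-- Lagrange interpolation: `x = (a - b)⁻¹((f - b)x - (f - a)x)`, where `(f - a)(f - b)x = 0`. -/
theorem mem_eigenspace_sup {W : Type*} [AddCommGroup W] [Module ℂ W] {f : Module.End ℂ W} {a b : ℂ}
    (hab : a ≠ b) {x : W} (h : f (f x) = (a + b) • f x - (a * b) • x) :
    x ∈ f.eigenspace a ⊔ f.eigenspace b := by
  have ha : (a - b)⁻¹ • (f x - b • x) ∈ f.eigenspace a := by
    refine Submodule.smul_mem _ _ (Module.End.mem_eigenspace_iff.mpr ?_)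
    rw [map_sub, map_smul, h]
    module
  have hb : -(a - b)⁻¹ • (f x - a • x) ∈ f.eigenspace b := by
    refine Submodule.smul_mem _ _ (Module.End.mem_eigenspace_iff.mpr ?_)
    rw [map_sub, map_smul, h]
    module
  convert Submodule.add_mem_sup ha hb using 1
  have hab' : a - b ≠ 0 := sub_ne_zero.mpr hab
  match_scalars
  · field_simp
    ring
  · ring

/-! ### The model representation -/

section Model

variable (n k : ℕ)

theorem leftMul_mul (p q : ℍ[ℝ]) : leftMul n p * leftMul n q = leftMul n (p * q) := by
  ext1 v
  funext a
  simp [leftMul_apply, mul_assoc]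

theorem leftMul_add (p q : ℍ[ℝ]) : leftMul n (p + q) = leftMul n p + leftMul n q := by
  ext1 v
  funext a
  simp [leftMul_apply, add_mul]

theorem leftMul_smul (c : ℝ) (q : ℍ[ℝ]) : leftMul n (c • q) = c • leftMul n q := by
  ext1 v
  funext a
  simp [leftMul_apply]

theorem leftMul_neg (q : ℍ[ℝ]) : leftMul n (-q) = -leftMul n q := by
  ext1 v
  funext a
  simp [leftMul_apply]

theorem leftMul_one : leftMul n 1 = 1 := by
  ext1 v
  funext a
  simp [leftMul_apply]

theorem isQuatTriple_quat : IsQuatTriple quatI quatJ quatK := by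
  have hI : quatI.re = 0 ∧ quatI.imI = 1 ∧ quatI.imJ = 0 ∧ quatI.imK = 0 := ⟨rfl, rfl, rfl, rfl⟩
  have hJ : quatJ.re = 0 ∧ quatJ.imI = 0 ∧ quatJ.imJ = 1 ∧ quatJ.imK = 0 := ⟨rfl, rfl, rfl, rfl⟩
  have hK : quatK.re = 0 ∧ quatK.imI = 0 ∧ quatK.imJ = 0 ∧ quatK.imK = 1 := ⟨rfl, rfl, rfl, rfl⟩
  constructor <;> ext <;> simp [hI, hJ, hK]

theorem isQuatTriple_model : IsQuatTriple (modelI n) (modelJ n) (modelK n) := by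
  have h := isQuatTriple_quat
  constructor <;>
    simp only [modelI, modelJ, modelK, leftMul_mul, h.mul_II, h.mul_JJ, h.mul_KK, h.mul_IJ,
      h.mul_JK, h.mul_KI, h.mul_JI, h.mul_KJ, h.mul_IK, leftMul_neg, leftMul_one]

theorem isSpTriple_lieAct :
    IsSpTriple (lieAct k (modelI n)) (lieAct k (modelJ n)) (lieAct k (modelK n)) := by
  have h := isQuatTriple_model n
  constructor <;> ext1 α <;>
    simp only [Module.End.mul_apply, LinearMap.add_apply] <;>
    rw [lieAct_comm, ← lieAct_add] <;>
    simp only [h.mul_IJ, h.mul_JK, h.mul_KI, h.mul_JI, h.mul_KJ, h.mul_IK, sub_neg_eq_add]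

/-- The Casimir operator of `Sp(1)` on `k`-forms. -/
def cas : Module.End ℂ (AltForm (HSpace n) k) :=
  casimir (lieAct k (modelI n)) (lieAct k (modelJ n)) (lieAct k (modelK n))

variable {V : Type*} [NormedAddCommGroup V] [NormedSpace ℝ V] {k}

open ContinuousAlternatingMap in
theorem alternatizeUncurryFin_mem_eigenspace {A : V →L[ℝ] V} {c : ℂ} {β : V →L[ℝ] AltForm V k}
    (h : ∀ v, lieAct k A (β v) - β (A v) = c • β v) :
    alternatizeUncurryFin β ∈ Module.End.eigenspace (lieAct (k + 1) A) c := by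
  rw [Module.End.mem_eigenspace_iff, lieAct_alternatizeUncurryFin k A (γ := c • β)
    (fun v => by rw [h]; rfl), alternatizeUncurryFin_smul]

variable (k)

theorem lieAct_zero_form (A : V →L[ℝ] V) : lieAct 0 A = 0 := by
  ext α v
  simp [lieAct_apply]

-- Induction on the degree: `β` is the mean of `β + iβI` and `β - iβI`, whose covector parts have
-- weights `1` and `-1`.
open ContinuousAlternatingMap in
theorem iSup_weight_eq_top :
    ⨆ m : ℤ, Module.End.eigenspace (lieAct k (modelI n)) (Complex.I * (m : ℂ)) = ⊤ := by
  induction k with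
  | zero =>
    refine top_le_iff.mp (le_iSup_of_le 0 fun α _ => ?_)
    simp [lieAct_zero_form]
  | succ k ih =>
    refine eq_top_of_alternatize_mem ih fun m β hβ => ?_
    have hII (v : HSpace n) : modelI n (modelI n v) = -v := by
      have := congrArg (fun f : HSpace n →L[ℝ] HSpace n => f v) (isQuatTriple_model n).mul_II
      simpa using this
    have hβ' (v : HSpace n) : lieAct k (modelI n) (β v) = (Complex.I * (m : ℂ)) • β v :=
      Module.End.mem_eigenspace_iff.mp (hβ v)
    have h1 : alternatizeUncurryFin (β + Complex.I • (β ∘L modelI n)) ∈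
        ⨆ m : ℤ, Module.End.eigenspace (lieAct (k + 1) (modelI n)) (Complex.I * (m : ℂ)) := by
      refine Submodule.mem_iSup_of_mem (m + 1) (alternatizeUncurryFin_mem_eigenspace fun v => ?_)
      simp only [_root_.add_apply, _root_.smul_apply, ContinuousLinearMap.comp_apply, map_add,
        map_smul, hβ', hII, map_neg]
      push_cast
      match_scalars
      · ring
      · linear_combination (-1 : ℂ) * Complex.I_sq
    have h2 : alternatizeUncurryFin (β - Complex.I • (β ∘L modelI n)) ∈
        ⨆ m : ℤ, Module.End.eigenspace (lieAct (k + 1) (modelI n)) (Complex.I * (m : ℂ)) := by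
      refine Submodule.mem_iSup_of_mem (m - 1) (alternatizeUncurryFin_mem_eigenspace fun v => ?_)
      simp only [_root_.sub_apply, _root_.smul_apply, ContinuousLinearMap.comp_apply, map_sub,
        map_smul, hβ', hII, map_neg]
      push_cast
      match_scalars
      · ring
      · linear_combination (-1 : ℂ) * Complex.I_sq
    have h3 := Submodule.smul_mem _ (1 / 2 : ℂ) (add_mem h1 h2)
    rw [← alternatizeUncurryFin_add, ← alternatizeUncurryFin_smul] at h3
    convert h3 using 2
    module

/-- `modelE` unfolds to `isotypic` for the three operators `lieAct`, so the abstract result applies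
as it stands. -/
theorem modelE_eq_eigenspace {r : ℤ} (hr : 0 ≤ r) :
    modelE n k r = (cas n k).eigenspace (-(r * (r + 2)) : ℂ) :=
  (isSpTriple_lieAct n k).isotypic_eq_eigenspace (iSup_weight_eq_top n k) hr

theorem modelE_of_neg {r : ℤ} (hr : r < 0) : modelE n k r = ⊥ :=
  (isSpTriple_lieAct n k).isotypic_of_neg hr

/-! ### The Clebsch–Gordan rule for covectors times forms -/

section Hom

open ContinuousAlternatingMap

variable (V)

/-- The space `V* ⊗ Λᵏ V*` of linear maps from `V` to `k`-forms. -/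
def HomForm : Type _ := V →L[ℝ] AltForm V k

namespace HomForm

instance : AddCommGroup (HomForm k V) := inferInstanceAs (AddCommGroup (V →L[ℝ] AltForm V k))

instance : Module ℂ (HomForm k V) := inferInstanceAs (Module ℂ (V →L[ℝ] AltForm V k))

instance : FunLike (HomForm k V) V (AltForm V k) :=
  inferInstanceAs (FunLike (V →L[ℝ] AltForm V k) V (AltForm V k))

variable {k V}

@[ext] protected theorem ext {β γ : HomForm k V} (h : ∀ v, β v = γ v) : β = γ :=
  ContinuousLinearMap.ext h

@[simp] protected theorem add_apply (β γ : HomForm k V) (v : V) : (β + γ) v = β v + γ v := rfl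

@[simp] protected theorem neg_apply (β : HomForm k V) (v : V) : (-β) v = -β v := rfl

@[simp] protected theorem zero_apply (v : V) : (0 : HomForm k V) v = 0 := rfl

@[simp] protected theorem smul_apply (c : ℂ) (β : HomForm k V) (v : V) : (c • β) v = c • β v := rfl

protected theorem map_neg (β : HomForm k V) (v : V) : β (-v) = -β v :=
  ContinuousLinearMap.map_neg (M := V) (M₂ := AltForm V k) β v

variable (k V)

/-- Skew-symmetrization, as a linear map. -/
def alt : HomForm k V →ₗ[ℂ] AltForm V (k + 1) where
  toFun β := alternatizeUncurryFin (𝕜 := ℝ) (E := V) (F := ℂ) β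
  map_add' _ _ := alternatizeUncurryFin_add _ _
  map_smul' c β := alternatizeUncurryFin_smul (𝕜 := ℝ) (E := V) (F := ℂ) c β

/-- The action of `A` on `V* ⊗ Λᵏ V*` through the first factor. -/
def covectorAct (A : V →L[ℝ] V) : Module.End ℂ (HomForm k V) where
  toFun β := -(ContinuousLinearMap.comp (M₂ := V) (M₃ := AltForm V k) β A : V →L[ℝ] AltForm V k)
  map_add' β γ := by ext1 v; exact neg_add (β (A v)) (γ (A v))
  map_smul' c β := by ext1 v; exact (smul_neg c (β (A v))).symm

variable {V}

@[simp] theorem covectorAct_apply (A : V →L[ℝ] V) (β : HomForm k V) (v : V) :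
    covectorAct k V A β v = -β (A v) := rfl

variable (V) [FiniteDimensional ℝ V]

/-- The action of `A` on `V* ⊗ Λᵏ V*` through the second factor. -/
def formAct (A : V →L[ℝ] V) : Module.End ℂ (HomForm k V) where
  toFun β := ContinuousLinearMap.comp (M₂ := AltForm V k)
    ((lieAct k A).toContinuousLinearMap.restrictScalars ℝ) (β : V →L[ℝ] AltForm V k)
  map_add' β γ := by ext1 v; exact map_add (lieAct k A) (β v) (γ v)
  map_smul' c β := by ext1 v; exact map_smul (lieAct k A) c (β v)

variable {V}

@[simp] theorem formAct_apply (A : V →L[ℝ] V) (β : HomForm k V) (v : V) :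
    formAct k V A β v = lieAct k A (β v) := rfl

theorem lieAct_alt (A : V →L[ℝ] V) (β : HomForm k V) :
    lieAct (k + 1) A (alt k V β) = alt k V ((formAct k V A + covectorAct k V A) β) :=
  lieAct_alternatizeUncurryFin k A fun v => (sub_eq_add_neg (lieAct k A (β v)) (β (A v))).symm

theorem commute_covectorAct_formAct (A B : V →L[ℝ] V) :
    Commute (covectorAct k V A) (formAct k V B) := by
  rw [commute_iff_eq]
  ext1 β
  ext1 v
  simp only [Module.End.mul_apply, covectorAct_apply, formAct_apply, map_neg]

theorem isSpTriple_formAct : IsSpTriple (formAct k (HSpace n) (modelI n))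
    (formAct k (HSpace n) (modelJ n)) (formAct k (HSpace n) (modelK n)) := by
  have h := isSpTriple_lieAct n k
  constructor <;> ext1 β <;> ext1 v
  · exact LinearMap.congr_fun h.mul_IJ (β v)
  · exact LinearMap.congr_fun h.mul_JK (β v)
  · exact LinearMap.congr_fun h.mul_KI (β v)

/-- Precomposition reverses products, and the sign in `covectorAct` restores the multiplication
table. -/
theorem isQuatTriple_covectorAct : IsQuatTriple (covectorAct k (HSpace n) (modelI n))
    (covectorAct k (HSpace n) (modelJ n)) (covectorAct k (HSpace n) (modelK n)) := by
  have h := isQuatTriple_model n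
  have hm (A B C : HSpace n →L[ℝ] HSpace n) (h : B * A = C) (v : HSpace n) :
      B (A v) = C v := by rw [← h]; rfl
  have h1 (v : HSpace n) : (-1 : HSpace n →L[ℝ] HSpace n) v = -v := rfl
  have h2 (A : HSpace n →L[ℝ] HSpace n) (v : HSpace n) : (-A) v = -A v := rfl
  constructor <;> ext1 β <;> ext1 v <;>
    simp only [Module.End.mul_apply, LinearMap.neg_apply, HomForm.neg_apply, covectorAct_apply,
      neg_neg, Module.End.one_apply]
  · rw [hm _ _ _ h.mul_II, h1, HomForm.map_neg]
  · rw [hm _ _ _ h.mul_JJ, h1, HomForm.map_neg]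
  · rw [hm _ _ _ h.mul_KK, h1, HomForm.map_neg]
  · rw [hm _ _ _ h.mul_JI, h2, HomForm.map_neg]
  · rw [hm _ _ _ h.mul_KJ, h2, HomForm.map_neg]
  · rw [hm _ _ _ h.mul_IK, h2, HomForm.map_neg]
  · rw [hm _ _ _ h.mul_IJ]
  · rw [hm _ _ _ h.mul_JK]
  · rw [hm _ _ _ h.mul_KI]

/-- The coupling of the two actions of `𝔰𝔭(1)` on `V* ⊗ Λᵏ V*`. -/
def coupling : Module.End ℂ (HomForm k (HSpace n)) :=
  formAct k _ (modelI n) * covectorAct k _ (modelI n) +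
    formAct k _ (modelJ n) * covectorAct k _ (modelJ n) +
    formAct k _ (modelK n) * covectorAct k _ (modelK n)

theorem casimir_formAct {c : ℂ} {β : HomForm k (HSpace n)} (hβ : ∀ v, cas n k (β v) = c • β v) :
    casimir (formAct k (HSpace n) (modelI n)) (formAct k (HSpace n) (modelJ n))
      (formAct k (HSpace n) (modelK n)) β = c • β := by
  ext1 v
  exact hβ v

/-- Since `alt` is equivariant, this is `casimir_add_quat` read through `alt`: the covector factor
contributes `-3`, the cross terms twice the coupling. -/
theorem cas_alt {c : ℂ} {β : HomForm k (HSpace n)} (hβ : ∀ v, cas n k (β v) = c • β v) :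
    cas n (k + 1) (alt k _ β) = alt k _ ((c - 3) • β + (2 : ℂ) • coupling n k β) := by
  have h := LinearMap.congr_fun (casimir_add_quat (isQuatTriple_covectorAct n k)
    (commute_covectorAct_formAct k (modelI n) (modelI n)).symm
    (commute_covectorAct_formAct k (modelJ n) (modelJ n)).symm
    (commute_covectorAct_formAct k (modelK n) (modelK n)).symm) β
  have h2 : cas n (k + 1) (alt k _ β) = alt k _
      (casimir (formAct k (HSpace n) (modelI n) + covectorAct k (HSpace n) (modelI n))
        (formAct k (HSpace n) (modelJ n) + covectorAct k (HSpace n) (modelJ n))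
        (formAct k (HSpace n) (modelK n) + covectorAct k (HSpace n) (modelK n)) β) := by
    simp only [cas, casimir]
    rw [LinearMap.add_apply, LinearMap.add_apply, Module.End.mul_apply, Module.End.mul_apply,
      Module.End.mul_apply]
    simp only [lieAct_alt]
    rw [← map_add, ← map_add]
    rfl
  rw [h2, h, LinearMap.add_apply, LinearMap.sub_apply, casimir_formAct n k hβ]
  congr 1
  change c • β - (β + β + β) + (coupling n k β + coupling n k β) = _
  module

theorem coupling_coupling {c : ℂ} {β : HomForm k (HSpace n)}
    (hβ : ∀ v, cas n k (β v) = c • β v) :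
    coupling n k (coupling n k β) = (-c) • β + (2 : ℂ) • coupling n k β := by
  have hcc (A B : HSpace n →L[ℝ] HSpace n) := commute_covectorAct_formAct k A B
  have h := LinearMap.congr_fun ((isSpTriple_formAct n k).sq_coupling
    (isQuatTriple_covectorAct n k) (hcc _ _) (hcc _ _) (hcc _ _) (hcc _ _) (hcc _ _) (hcc _ _)
    (hcc _ _) (hcc _ _) (hcc _ _)) β
  refine h.trans ?_
  rw [LinearMap.add_apply, LinearMap.neg_apply, casimir_formAct n k hβ]
  change -(c • β) + (coupling n k β + coupling n k β) = _
  module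

/-- The coupling does not leave the Casimir eigenspace, so `cas_alt` can be applied a second time.
-/
theorem cas_coupling {c : ℂ} {β : HomForm k (HSpace n)}
    (hβ : ∀ v, cas n k (β v) = c • β v) (v : HSpace n) :
    cas n k (coupling n k β v) = c • coupling n k β v := by
  have h := isSpTriple_lieAct n k
  simp only [cas] at hβ ⊢
  simp only [coupling, LinearMap.add_apply (M := HomForm k (HSpace n)),
    Module.End.mul_apply (M := HomForm k (HSpace n)), HomForm.add_apply,
    formAct_apply, covectorAct_apply, map_neg, map_add, h.commute_casimir_I, h.commute_casimir_J,
    h.commute_casimir_K, hβ, map_smul, smul_add, smul_neg]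

theorem alt_mem_modelE {r : ℤ} {β : HomForm k (HSpace n)} (hβ : ∀ v, β v ∈ modelE n k r) :
    alt k _ β ∈ modelE n (k + 1) (r + 1) ⊔ modelE n (k + 1) (r - 1) := by
  rcases lt_trichotomy r 0 with hr | rfl | hr
  · have h0 : β = 0 := by
      ext1 v
      have := hβ v
      rw [modelE_of_neg n k hr] at this
      exact (Submodule.mem_bot ℂ).mp this
    rw [h0, _root_.map_zero]
    exact zero_mem _
  -- For `r = 0` the quadratic equation would still allow the Casimir value `1`, although the
  -- component of weight `-1` is zero. Invariance of the values of `β` makes the coupling vanish and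
  -- leaves the value `-3`.
  · refine Submodule.mem_sup_left ?_
    have hinv (v : HSpace n) := (isSpTriple_lieAct n k).invariant_of_mem_isotypic_zero (hβ v)
    have hc (v : HSpace n) : cas n k (β v) = (0 : ℂ) • β v := by
      obtain ⟨h1, h2, h3⟩ := hinv v
      rw [cas, casimir, LinearMap.add_apply, LinearMap.add_apply, Module.End.mul_apply,
        Module.End.mul_apply, Module.End.mul_apply, h1, h2, h3, _root_.map_zero, _root_.map_zero,
        _root_.map_zero, add_zero, add_zero]
      exact (zero_smul ℂ (β v)).symm
    have h0 : coupling n k β = 0 := by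
      ext1 v
      simp only [coupling, LinearMap.add_apply (M := HomForm k (HSpace n)),
        Module.End.mul_apply (M := HomForm k (HSpace n)), HomForm.add_apply,
        formAct_apply, covectorAct_apply, map_neg, (hinv _).1, (hinv _).2.1, (hinv _).2.2]
      simp only [neg_zero, add_zero, HomForm.zero_apply]
    rw [modelE_eq_eigenspace n (k + 1) (by norm_num), Module.End.mem_eigenspace_iff,
      cas_alt n k hc, h0, ← map_smul]
    congr 1
    push_cast
    module
  · have hc (v : HSpace n) : cas n k (β v) = (-(r * (r + 2)) : ℂ) • β v :=
      Module.End.mem_eigenspace_iff.mp (modelE_eq_eigenspace n k hr.le ▸ hβ v)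
    rw [modelE_eq_eigenspace n (k + 1) (by lia), modelE_eq_eigenspace n (k + 1) (by lia)]
    -- The roots `-r` and `r + 2` of the coupling yield the Casimir values `-(r + 1)(r + 3)` and
    -- `-(r - 1)(r + 1)`, which differ by `4(r + 1)`.
    refine mem_eigenspace_sup ?_ ?_
    · push_cast
      intro h
      have h2 : (r : ℂ) + 1 = 0 := by linear_combination (-1 / 4 : ℂ) * h
      have h3 : r + 1 = 0 := by exact_mod_cast h2
      lia
    · rw [cas_alt n k hc, cas_alt n k (c := (-(r * (r + 2)) : ℂ)), ← map_smul (alt k _),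
        ← map_smul (alt k _), ← map_sub]
      · congr 1
        rw [map_add, map_smul, map_smul, coupling_coupling n k hc]
        push_cast
        module
      · intro v
        simp only [HomForm.add_apply, HomForm.smul_apply, map_add, map_smul, hc,
          cas_coupling n k hc]
        module

end HomForm

/-- The Clebsch–Gordan rule: the exterior product of a covector and an element of `E_{k,r}` lies
in `E_{k+1,r+1} ⊕ E_{k+1,r-1}`. -/
theorem alternatizeUncurryFin_mem_modelE {r : ℤ} {β : HSpace n →L[ℝ] AltForm (HSpace n) k}
    (hβ : ∀ v, β v ∈ modelE n k r) :
    alternatizeUncurryFin β ∈ modelE n (k + 1) (r + 1) ⊔ modelE n (k + 1) (r - 1) :=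
  HomForm.alt_mem_modelE (β := β) n k hβ

end Hom

/-- The highest weights which occur in `k`-forms have the parity of `k` and are at most `k`. -/
theorem iSup_modelE_parity :
    ⨆ r : {r : ℤ // 0 ≤ r ∧ r ≤ k ∧ Even (k - r)}, modelE n k r = ⊤ := by
  induction k with
  | zero =>
    refine top_le_iff.mp (le_iSup_of_le ⟨0, le_rfl, by simp, by simp⟩ fun α _ => ?_)
    rw [modelE_eq_eigenspace n 0 le_rfl]
    simp [cas, casimir, lieAct_zero_form]
  | succ k ih =>
    refine eq_top_of_alternatize_mem ih ?_
    rintro ⟨r, hr0, hrk, hpar⟩ β hβ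
    refine sup_le (α := Submodule ℂ (AltForm (HSpace n) (k + 1))) ?_ ?_
      (alternatizeUncurryFin_mem_modelE n k hβ)
    · exact le_iSup_of_le (⟨r + 1, by lia, by push_cast; lia, by
        push_cast; simpa using hpar⟩ :
          {r : ℤ // 0 ≤ r ∧ r ≤ (k + 1 : ℕ) ∧ Even (((k + 1 : ℕ) : ℤ) - r)}) le_rfl
    · rcases hr0.eq_or_lt with rfl | hr
      · rw [modelE_of_neg n (k + 1) (by norm_num)]
        exact bot_le
      · exact le_iSup_of_le (⟨r - 1, by lia, by push_cast; lia, by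
          push_cast; grind⟩ : {r : ℤ // 0 ≤ r ∧ r ≤ (k + 1 : ℕ) ∧ Even (((k + 1 : ℕ) : ℤ) - r)})
          le_rfl

/-- The function `r(r + 2)` is injective on `r ≥ 0`, so nonzero components have different Casimir
eigenvalues. -/
theorem iSupIndep_modelE : iSupIndep (modelE n k) := by
  intro r
  rcases lt_or_ge r 0 with hr | hr
  · rw [modelE_of_neg n k hr]
    exact disjoint_bot_left
  · rw [modelE_eq_eigenspace n k hr]
    refine ((cas n k).eigenspaces_iSupIndep _).mono_right (iSup₂_le fun s hs => ?_)
    rcases lt_or_ge s 0 with hs0 | hs0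
    · rw [modelE_of_neg n k hs0]
      exact bot_le
    · rw [modelE_eq_eigenspace n k hs0]
      refine le_iSup₂_of_le (-(s * (s + 2)) : ℂ) (fun h => hs ?_) le_rfl
      have h2 : s * (s + 2) = r * (r + 2) := by
        have := neg_injective h
        exact_mod_cast this
      nlinarith

theorem iSup_modelE : ⨆ r, modelE n k r = ⊤ :=
  top_le_iff.mp (iSup_modelE_parity n k ▸ iSup_le fun r => le_iSup (modelE n k) r)

/-- The admissible weights already span, and any further component is independent of them. -/
theorem modelE_eq_bot {r : ℤ} (hr : ¬(0 ≤ r ∧ r ≤ k ∧ Even (k - r))) : modelE n k r = ⊥ := by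
  have h := iSupIndep_modelE n k r
  have htop : ⨆ s, ⨆ (_ : s ≠ r), modelE n k s = ⊤ := by
    rw [eq_top_iff, ← iSup_modelE_parity n k]
    exact iSup_le fun s => le_iSup₂_of_le s.1 (fun h => hr (h ▸ s.2)) le_rfl
  rw [htop, disjoint_top] at h
  exact h

end Model

/-! ### Invariance of the isotypic components -/

section Invariance

variable (n k : ℕ)

theorem lieAct_zero {V : Type*} [NormedAddCommGroup V] [NormedSpace ℝ V] (α : AltForm V k) :
    lieAct k (0 : V →L[ℝ] V) α = 0 := by
  simp only [lieAct, LinearMap.coe_mk, AddHom.coe_mk, map_zero, neg_zero]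

theorem leftMul_vecMul (q : ℍ[ℝ]) (v : HSpace n) (B : Matrix (Fin n) (Fin n) ℍ[ℝ]) :
    leftMul n q (v ᵥ* B) = leftMul n q v ᵥ* B := by
  funext a
  simp [leftMul_apply, Matrix.vecMul, dotProduct, Finset.mul_sum, mul_assoc]

theorem leftMul_eq_of_re_eq_zero {p : ℍ[ℝ]} (hp : p.re = 0) :
    leftMul n p = p.imI • modelI n + p.imJ • modelJ n + p.imK • modelK n := by
  simp only [modelI, modelJ, modelK, ← leftMul_smul, ← leftMul_add]
  congr 1
  have hI : quatI.re = 0 ∧ quatI.imI = 1 ∧ quatI.imJ = 0 ∧ quatI.imK = 0 := ⟨rfl, rfl, rfl, rfl⟩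
  have hJ : quatJ.re = 0 ∧ quatJ.imI = 0 ∧ quatJ.imJ = 1 ∧ quatJ.imK = 0 := ⟨rfl, rfl, rfl, rfl⟩
  have hK : quatK.re = 0 ∧ quatK.imI = 0 ∧ quatK.imJ = 0 ∧ quatK.imK = 1 := ⟨rfl, rfl, rfl, rfl⟩
  ext <;> simp [hI, hJ, hK, hp]

theorem lieAct_leftMul {p : ℍ[ℝ]} (hp : p.re = 0) (α : AltForm (HSpace n) k) :
    lieAct k (leftMul n p) α = (p.imI : ℂ) • lieAct k (modelI n) α +
      (p.imJ : ℂ) • lieAct k (modelJ n) α + (p.imK : ℂ) • lieAct k (modelK n) α := by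
  rw [leftMul_eq_of_re_eq_zero n hp, lieAct_add, lieAct_add, lieAct_smul, lieAct_smul, lieAct_smul]

theorem cas_apply (α : AltForm (HSpace n) k) : cas n k α =
    lieAct k (modelI n) (lieAct k (modelI n) α) + lieAct k (modelJ n) (lieAct k (modelJ n) α) +
      lieAct k (modelK n) (lieAct k (modelK n) α) := rfl

/-- Each component is zero or a Casimir eigenspace; invariance under the group and under its Lie
algebra thereby reduces to commutation with `cas`. -/
theorem lieAct_mem_modelE_of_commute {f : Module.End ℂ (AltForm (HSpace n) k)}
    (hf : ∀ α, cas n k (f α) = f (cas n k α)) {r : ℤ} {α : AltForm (HSpace n) k}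
    (hα : α ∈ modelE n k r) : f α ∈ modelE n k r := by
  rcases lt_or_ge r 0 with hr | hr
  · rw [modelE_of_neg n k hr] at hα ⊢
    rw [(Submodule.mem_bot ℂ).mp hα, map_zero]
    exact zero_mem _
  · rw [modelE_eq_eigenspace n k hr, Module.End.mem_eigenspace_iff] at hα ⊢
    rw [hf, hα, map_smul]

/-- The Lie algebra of `Sp(1)GL(n,ℍ)` preserves the isotypic components. -/
theorem lieAct_mem_modelE {T : HSpace n →L[ℝ] HSpace n} (hT : MemLieSpGL n T) {r : ℤ}
    {α : AltForm (HSpace n) k} (hα : α ∈ modelE n k r) : lieAct k T α ∈ modelE n k r := by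
  obtain ⟨p, B, hp, hpB⟩ := hT
  have hsp := isSpTriple_lieAct n k
  refine lieAct_mem_modelE_of_commute n k (f := lieAct k T) (fun α => ?_) hα
  -- `T` is the sum of a right multiplication, which commutes with `I`, `J`, `K`, and a combination
  -- of `I`, `J`, `K`, which commutes with the Casimir.
  have hR (v : HSpace n) : (T - leftMul n p) v = v ᵥ* B := by
    rw [_root_.sub_apply, hpB, add_sub_cancel_left]
  have hcomm (a : ℍ[ℝ]) (α : AltForm (HSpace n) k) :
      lieAct k (leftMul n a) (lieAct k (T - leftMul n p) α) =
        lieAct k (T - leftMul n p) (lieAct k (leftMul n a) α) := by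
    rw [lieAct_comm,
      show leftMul n a * (T - leftMul n p) - (T - leftMul n p) * leftMul n a = 0 from ?_]
    · rw [lieAct_zero, add_zero]
    · ext1 v
      change leftMul n a ((T - leftMul n p) v) - (T - leftMul n p) (leftMul n a v) = 0
      rw [hR, hR, leftMul_vecMul, sub_self]
  have hT' (α : AltForm (HSpace n) k) : lieAct k T α =
      lieAct k (T - leftMul n p) α + lieAct k (leftMul n p) α := by
    rw [← lieAct_add, sub_add_cancel]
  have h1 : cas n k (lieAct k (T - leftMul n p) α) = lieAct k (T - leftMul n p) (cas n k α) := by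
    simp only [cas_apply, modelI, modelJ, modelK, hcomm, map_add]
  have h2 : cas n k (lieAct k (leftMul n p) α) = lieAct k (leftMul n p) (cas n k α) := by
    simp only [lieAct_leftMul n k hp, cas, map_add, map_smul, hsp.commute_casimir_I,
      hsp.commute_casimir_J, hsp.commute_casimir_K]
  rw [hT', hT', map_add, h1, h2]

theorem norm_eq_one_iff_sum_sq (q : ℍ[ℝ]) :
    ‖q‖ = 1 ↔ q.re ^ 2 + q.imI ^ 2 + q.imJ ^ 2 + q.imK ^ 2 = 1 := by
  rw [← Quaternion.normSq_def', Quaternion.normSq_eq_norm_mul_self]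
  constructor
  · intro h; simp [h]
  · intro h
    nlinarith [norm_nonneg q]

/-- The Casimir operator is invariant under `Sp(1)GL(n,ℍ)`. -/
theorem cas_pullback {g : HSpace n ≃L[ℝ] HSpace n} (hg : MemSpGL n g)
    (α : AltForm (HSpace n) k) :
    cas n k (pullback (g : HSpace n →L[ℝ] HSpace n) k α) =
      pullback (g : HSpace n →L[ℝ] HSpace n) k (cas n k α) := by
  obtain ⟨q, A, hq, hgA⟩ := hg
  have hq1 : q * star q = 1 := by
    rw [Quaternion.self_mul_star, Quaternion.normSq_eq_norm_mul_self, hq]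
    simp
  have hN := (norm_eq_one_iff_sum_sq q).mp hq
  -- As `a q = q (q̄ a q)`, pulling back by `g` rotates the triple `i, j, k`.
  have hpull (a : ℍ[ℝ]) (α : AltForm (HSpace n) k) :
      pullback (g : HSpace n →L[ℝ] HSpace n) k (lieAct k (leftMul n a) α) =
        lieAct k (leftMul n (star q * a * q)) (pullback (g : HSpace n →L[ℝ] HSpace n) k α) := by
    refine pullback_lieAct k (fun v => ?_) α
    change leftMul n a (g v) = g (leftMul n (star q * a * q) v)
    rw [hgA, hgA, ← leftMul_vecMul]
    change (leftMul n a * leftMul n q) _ = (leftMul n q * leftMul n (star q * a * q)) _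
    rw [leftMul_mul, leftMul_mul, ← mul_assoc, ← mul_assoc, hq1, one_mul]
  have hI : quatI.re = 0 ∧ quatI.imI = 1 ∧ quatI.imJ = 0 ∧ quatI.imK = 0 := ⟨rfl, rfl, rfl, rfl⟩
  have hJ : quatJ.re = 0 ∧ quatJ.imI = 0 ∧ quatJ.imJ = 1 ∧ quatJ.imK = 0 := ⟨rfl, rfl, rfl, rfl⟩
  have hK : quatK.re = 0 ∧ quatK.imI = 0 ∧ quatK.imJ = 0 ∧ quatK.imK = 1 := ⟨rfl, rfl, rfl, rfl⟩
  have hre (a : ℍ[ℝ]) (ha : a.re = 0) : (star q * a * q).re = 0 := by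
    simp [ha]; ring
  rw [cas_apply n k α, map_add, map_add]
  simp only [modelI, modelJ, modelK, hpull]
  rw [lieAct_leftMul n k (hre _ hI.1), lieAct_leftMul n k (hre _ hI.1),
    lieAct_leftMul n k (hre _ hJ.1), lieAct_leftMul n k (hre _ hJ.1),
    lieAct_leftMul n k (hre _ hK.1), lieAct_leftMul n k (hre _ hK.1), cas_apply]
  generalize pullback (g : HSpace n →L[ℝ] HSpace n) k α = γ
  simp only [map_add, map_smul]
  have hNc : (q.re : ℂ) ^ 2 + (q.imI : ℂ) ^ 2 + (q.imJ : ℂ) ^ 2 + (q.imK : ℂ) ^ 2 = 1 := by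
    exact_mod_cast hN
  simp only [Quaternion.re_mul, Quaternion.imI_mul, Quaternion.imJ_mul, Quaternion.imK_mul,
    Quaternion.re_star, Quaternion.imI_star, Quaternion.imJ_star, Quaternion.imK_star,
    hI, hJ, hK]
  push_cast
  match_scalars
  -- The matrix of `a ↦ q̄ a q` has rows and columns of squared length `|q|⁴`, and `|q|⁴ - 1 = (|q|²
  -- + 1)(|q|² - 1)`. The mixed coefficients cancel without using `|q| = 1`.
  · linear_combination
      -((q.re : ℂ) ^ 2 + (q.imI : ℂ) ^ 2 + (q.imJ : ℂ) ^ 2 + (q.imK : ℂ) ^ 2 + 1) * hNc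
  · linear_combination
      -((q.re : ℂ) ^ 2 + (q.imI : ℂ) ^ 2 + (q.imJ : ℂ) ^ 2 + (q.imK : ℂ) ^ 2 + 1) * hNc
  · linear_combination
      -((q.re : ℂ) ^ 2 + (q.imI : ℂ) ^ 2 + (q.imJ : ℂ) ^ 2 + (q.imK : ℂ) ^ 2 + 1) * hNc
  all_goals ring

theorem pullback_mem_modelE {g : HSpace n ≃L[ℝ] HSpace n} (hg : MemSpGL n g) {r : ℤ}
    {α : AltForm (HSpace n) k} (hα : α ∈ modelE n k r) :
    pullback (g : HSpace n →L[ℝ] HSpace n) k α ∈ modelE n k r :=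
  lieAct_mem_modelE_of_commute n k (f := pullback (g : HSpace n →L[ℝ] HSpace n) k)
    (cas_pullback n k hg) hα

end Invariance

/-! ### Complex conjugation of forms -/

section Conj

/-- Complex conjugation of forms. -/
def conjForm {V : Type*} [AddCommGroup V] [Module ℝ V] [TopologicalSpace V] {k : ℕ}
    (α : AltForm V k) : AltForm V k :=
  (Complex.conjCLE : ℂ →L[ℝ] ℂ).compContinuousAlternatingMap α

section

variable {V W : Type*} [AddCommGroup V] [Module ℝ V] [TopologicalSpace V]
  [AddCommGroup W] [Module ℝ W] [TopologicalSpace W] {k : ℕ}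

@[simp] theorem conjForm_apply (α : AltForm V k) (v : Fin k → V) :
    conjForm α v = starRingEnd ℂ (α v) := rfl

theorem conjForm_add (α β : AltForm V k) : conjForm (α + β) = conjForm α + conjForm β := by
  ext v; simp

theorem conjForm_smul (c : ℂ) (α : AltForm V k) :
    conjForm (c • α) = starRingEnd ℂ c • conjForm α := by
  ext v; simp

theorem conjForm_zero : conjForm (0 : AltForm V k) = 0 := by
  ext v; simp

theorem pullback_conjForm (A : V →L[ℝ] W) (α : AltForm W k) :
    pullback A k (conjForm α) = conjForm (pullback A k α) := rfl

theorem conjForm_eq_self_iff (α : AltForm V k) : conjForm α = α ↔ ∀ v, (α v).im = 0 := by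
  simp only [ContinuousAlternatingMap.ext_iff, conjForm_apply, Complex.conj_eq_iff_im]

end

theorem lieAct_conjForm {V : Type*} [NormedAddCommGroup V] [NormedSpace ℝ V] {k : ℕ}
    (A : V →L[ℝ] V) (α : AltForm V k) : lieAct k A (conjForm α) = conjForm (lieAct k A α) := by
  ext v
  simp [lieAct_apply]

/-- The Casimir is a real operator and its eigenvalue `-r(r + 2)` is real. -/
theorem conjForm_mem_modelE {n k : ℕ} {r : ℤ} {α : AltForm (HSpace n) k}
    (hα : α ∈ modelE n k r) : conjForm α ∈ modelE n k r := by
  rcases lt_or_ge r 0 with hr | hr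
  · rw [modelE_of_neg n k hr] at hα ⊢
    rw [(Submodule.mem_bot ℂ).mp hα, conjForm_zero]
    exact zero_mem _
  · rw [modelE_eq_eigenspace n k hr, Module.End.mem_eigenspace_iff] at hα ⊢
    rw [cas_apply] at hα ⊢
    simp only [lieAct_conjForm, ← conjForm_add]
    have hc : starRingEnd ℂ (-(r * (r + 2)) : ℂ) = -(r * (r + 2)) := by
      rw [map_neg, map_mul, map_add, Complex.conj_ofNat, map_intCast]
    rw [hα, conjForm_smul, hc]

end Conj

/-! ### Real dimension four -/

section Four

open ContinuousAlternatingMap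

/-- The real basis `1, i, j, k` of `ℍ¹`. -/
def basisFour : Module.Basis (Fin 4) ℝ (HSpace 1) :=
  (QuaternionAlgebra.basisOneIJK (-1 : ℝ) 0 (-1)).map
    (LinearEquiv.funUnique (Fin 1) ℝ ℍ[ℝ]).symm

theorem basisFour_apply : basisFour 0 = (fun _ => 1) ∧ basisFour 1 = (fun _ => quatI) ∧
    basisFour 2 = (fun _ => quatJ) ∧ basisFour 3 = (fun _ => quatK) := by
  have h (i : Fin 4) : basisFour i =
      fun _ => QuaternionAlgebra.basisOneIJK (-1 : ℝ) 0 (-1) i := rfl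
  have h' (v : Fin 4 → ℝ) : (QuaternionAlgebra.linearEquivTuple (-1 : ℝ) 0 (-1)).symm v =
      ⟨v 0, v 1, v 2, v 3⟩ := rfl
  simp only [h, QuaternionAlgebra.basisOneIJK, Module.Basis.coe_ofEquivFun, h']
  refine ⟨?_, ?_, ?_, ?_⟩ <;> funext a <;> ext <;> simp [quatI, quatJ, quatK]

theorem modelI_basisFour : modelI 1 (basisFour 0) = basisFour 1 ∧
    modelI 1 (basisFour 1) = -basisFour 0 ∧ modelI 1 (basisFour 2) = basisFour 3 ∧
    modelI 1 (basisFour 3) = -basisFour 2 := by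
  obtain ⟨h0, h1, h2, h3⟩ := basisFour_apply
  have h := isQuatTriple_quat
  rw [h0, h1, h2, h3]
  refine ⟨?_, ?_, ?_, ?_⟩ <;> funext a <;>
    simp [modelI, leftMul_apply, h.mul_II, h.mul_IJ, h.mul_IK]

theorem modelJ_basisFour : modelJ 1 (basisFour 0) = basisFour 2 ∧
    modelJ 1 (basisFour 1) = -basisFour 3 ∧ modelJ 1 (basisFour 2) = -basisFour 0 ∧
    modelJ 1 (basisFour 3) = basisFour 1 := by
  obtain ⟨h0, h1, h2, h3⟩ := basisFour_apply
  have h := isQuatTriple_quat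
  rw [h0, h1, h2, h3]
  refine ⟨?_, ?_, ?_, ?_⟩ <;> funext a <;>
    simp [modelJ, leftMul_apply, h.mul_JI, h.mul_JJ, h.mul_JK]

theorem modelK_basisFour : modelK 1 (basisFour 0) = basisFour 3 ∧
    modelK 1 (basisFour 1) = basisFour 2 ∧ modelK 1 (basisFour 2) = -basisFour 1 ∧
    modelK 1 (basisFour 3) = -basisFour 0 := by
  obtain ⟨h0, h1, h2, h3⟩ := basisFour_apply
  have h := isQuatTriple_quat
  rw [h0, h1, h2, h3]
  refine ⟨?_, ?_, ?_, ?_⟩ <;> funext a <;>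
    simp [modelK, leftMul_apply, h.mul_KI, h.mul_KJ, h.mul_KK]

section

variable {V : Type*} [NormedAddCommGroup V] [NormedSpace ℝ V] (α : AltForm V 3) (x y z : V)

theorem lieAct_three (A : V →L[ℝ] V) : lieAct 3 A α ![x, y, z] =
    -(α ![A x, y, z] + α ![x, A y, z] + α ![x, y, A z]) := by
  rw [lieAct_apply, Fin.sum_univ_three]
  congr 4
  · funext i; fin_cases i <;> rfl
  · funext i; fin_cases i <;> rfl
  · funext i; fin_cases i <;> rfl

theorem three_swap_left : α ![y, x, z] = -α ![x, y, z] := by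
  refine Eq.trans (congrArg α ?_)
    (α.toAlternatingMap.map_swap ![x, y, z] (show (0 : Fin 3) ≠ 1 by decide))
  funext i; fin_cases i <;> rfl

theorem three_swap_right : α ![x, z, y] = -α ![x, y, z] := by
  refine Eq.trans (congrArg α ?_)
    (α.toAlternatingMap.map_swap ![x, y, z] (show (1 : Fin 3) ≠ 2 by decide))
  funext i; fin_cases i <;> rfl

theorem three_eq_left : α ![x, x, z] = 0 :=
  α.map_eq_zero_of_eq ![x, x, z] (i := 0) (j := 1) rfl (by decide)

theorem three_eq_right : α ![x, y, y] = 0 :=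
  α.map_eq_zero_of_eq ![x, y, y] (i := 1) (j := 2) rfl (by decide)

theorem three_eq_outer : α ![x, y, x] = 0 :=
  α.map_eq_zero_of_eq ![x, y, x] (i := 0) (j := 2) rfl (by decide)

theorem three_neg_left : α ![-x, y, z] = -α ![x, y, z] := by
  have h := α.toAlternatingMap.map_update_neg ![x, y, z] 0 x
  rwa [show Function.update ![x, y, z] 0 (-x) = ![-x, y, z] by funext i; fin_cases i <;> rfl,
    show Function.update ![x, y, z] 0 x = ![x, y, z] by funext i; fin_cases i <;> rfl] at h

theorem three_neg_middle : α ![x, -y, z] = -α ![x, y, z] := by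
  rw [three_swap_left, three_neg_left, three_swap_left α x y z, neg_neg]

theorem three_neg_right : α ![x, y, -z] = -α ![x, y, z] := by
  rw [three_swap_right, three_neg_middle, three_swap_right α x y z, neg_neg]

end

/-- On three-forms in real dimension four the Casimir operator acts by `-3`. -/
theorem cas_three (α : AltForm (HSpace 1) 3) : cas 1 3 α = (-3 : ℂ) • α := by
  obtain ⟨hI0, hI1, hI2, hI3⟩ := modelI_basisFour
  obtain ⟨hJ0, hJ1, hJ2, hJ3⟩ := modelJ_basisFour
  obtain ⟨hK0, hK1, hK2, hK3⟩ := modelK_basisFour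
  -- The invariant volume form identifies `Λ³V*` with `V`, of weight `1`, whence the value `-1 · 3`.
  -- It is checked on increasing triples of basis vectors; alternation gives the others.
  set γ := cas 1 3 α - (-3 : ℂ) • α with hγ
  have key : ∀ a b c : Fin 4, a < b → b < c →
      γ ![basisFour a, basisFour b, basisFour c] = 0 := by
    intro a b c hab hbc
    obtain ⟨rfl, rfl, rfl⟩ | ⟨rfl, rfl, rfl⟩ | ⟨rfl, rfl, rfl⟩ | ⟨rfl, rfl, rfl⟩ :
        (a = 0 ∧ b = 1 ∧ c = 2) ∨ (a = 0 ∧ b = 1 ∧ c = 3) ∨ (a = 0 ∧ b = 2 ∧ c = 3) ∨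
          (a = 1 ∧ b = 2 ∧ c = 3) := by lia
    all_goals
      rw [hγ, ContinuousAlternatingMap.sub_apply, ContinuousAlternatingMap.smul_apply, cas_apply,
        ContinuousAlternatingMap.add_apply, ContinuousAlternatingMap.add_apply]
      simp only [lieAct_three, hI0, hI1, hI2, hI3, hJ0, hJ1, hJ2, hJ3, hK0, hK1, hK2, hK3,
        three_neg_left, three_neg_middle, three_neg_right, three_eq_left, three_eq_right,
        three_eq_outer, neg_neg, smul_eq_mul]
      ring
  have hγ0 : γ = 0 := by
    have hzero : ∀ a b c : Fin 4, γ ![basisFour a, basisFour b, basisFour c] = 0 := by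
      have step : ∀ a b c : Fin 4, a < b → γ ![basisFour a, basisFour b, basisFour c] = 0 := by
        intro a b c hab
        rcases lt_trichotomy b c with h | rfl | h
        · exact key a b c hab h
        · exact three_eq_right _ _ _
        · rw [three_swap_right, neg_eq_zero]
          rcases lt_trichotomy a c with h' | rfl | h'
          · exact key a c b h' h
          · exact three_eq_left _ _ _
          · rw [three_swap_left, key c a b h' hab, neg_zero]
      intro a b c
      rcases lt_trichotomy a b with h | rfl | h
      · exact step a b c h
      · exact three_eq_left _ _ _
      · rw [three_swap_left, step b a c h, neg_zero]
    refine ContinuousAlternatingMap.toAlternatingMap_injective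
      (Module.Basis.ext_alternating basisFour fun v _ => ?_)
    have := hzero (v 0) (v 1) (v 2)
    change γ (fun i => basisFour (v i)) = 0
    rw [← this]
    congr 1; funext i; fin_cases i <;> rfl
  exact sub_eq_zero.mp hγ0

/-- In real dimension four, the components of weights `r ± 1` in degree `k + 1` exhaust the
`(k + 1)`-forms whenever `r` is a weight of the `k`-forms. -/
theorem modelE_one_sup_eq_top {k : ℕ} {r : ℤ} (hr : modelE 1 k r ≠ ⊥) :
    modelE 1 (k + 1) (r + 1) ⊔ modelE 1 (k + 1) (r - 1) = ⊤ := by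
  have hpar : 0 ≤ r ∧ r ≤ k ∧ Even (k - r) := by
    by_contra h; exact hr (modelE_eq_bot 1 k h)
  -- Parity allows the weights `1` and `3` in `Λ³`; the Casimir value leaves only `1`. This settles
  -- `k = 2` and excludes `r = 3` for `k = 3`.
  have h3 : modelE 1 3 1 = ⊤ := by
    rw [modelE_eq_eigenspace 1 3 zero_le_one, eq_top_iff]
    intro α _
    rw [Module.End.mem_eigenspace_iff, cas_three]
    congr 1; norm_num
  have h3' {s : ℤ} (hs : s ≠ 1) : modelE 1 3 s = ⊥ := by
    have := (iSupIndep_modelE 1 3).pairwiseDisjoint hs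
    rwa [Function.onFun, h3, disjoint_top] at this
  have huse {j : ℕ} (U : Submodule ℂ (AltForm (HSpace 1) j))
      (hU : ∀ s : ℤ, 0 ≤ s → s ≤ j → Even (j - s) → modelE 1 j s ≤ U) : U = ⊤ := by
    rw [eq_top_iff, ← iSup_modelE_parity 1 j]
    exact iSup_le fun s => hU s s.2.1 s.2.2.1 s.2.2.2
  obtain rfl | rfl | rfl | rfl | hk : k = 0 ∨ k = 1 ∨ k = 2 ∨ k = 3 ∨ 4 ≤ k := by lia
  · obtain rfl : r = 0 := by push_cast at hpar; lia
    refine huse _ fun s h0 h1 h2 => ?_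
    obtain rfl : s = 1 := by push_cast at h1 h2; grind
    exact le_sup_left
  · obtain rfl : r = 1 := by push_cast at hpar; grind
    refine huse _ fun s h0 h1 h2 => ?_
    obtain rfl | rfl : s = 0 ∨ s = 2 := by push_cast at h1 h2; grind
    · exact le_sup_right
    · exact le_sup_left
  · obtain rfl | rfl : r = 0 ∨ r = 2 := by push_cast at hpar; grind
    · exact eq_top_iff.mpr (h3.ge.trans le_sup_left)
    · exact eq_top_iff.mpr (h3.ge.trans le_sup_right)
  · obtain rfl : r = 1 := by
      by_contra h; exact hr (h3' h)
    refine eq_top_of_alternatize_mem (S := fun _ : Unit => (⊤ : Submodule ℂ (AltForm (HSpace 1) 3)))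
      (by simp) fun _ β _ => ?_
    exact alternatizeUncurryFin_mem_modelE 1 3 fun v => by rw [h3]; trivial
  · have : Subsingleton (AltForm (HSpace 1) (k + 1)) := by
      refine subsingleton_of_forall_eq 0 fun α => ?_
      ext v
      refine α.toAlternatingMap.map_linearDependent v fun h => ?_
      have := h.fintype_card_le_finrank
      rw [Module.finrank_eq_card_basis basisFour] at this
      simp at this
      lia
    exact Subsingleton.elim _ _

end Four

/-! ### The decomposition at a point -/

section PullbackEquiv

variable {V W : Type*} [AddCommGroup V] [Module ℝ V] [TopologicalSpace V]
  [AddCommGroup W] [Module ℝ W] [TopologicalSpace W]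

/-- Pullback along a continuous linear equivalence. -/
def pullbackEquiv (u : V ≃L[ℝ] W) (k : ℕ) : AltForm W k ≃ₗ[ℂ] AltForm V k where
  __ := pullback (u : V →L[ℝ] W) k
  invFun := pullback (u.symm : W →L[ℝ] V) k
  left_inv α := by
    ext v
    change α (fun i => u (u.symm (v i))) = α v
    simp
  right_inv α := by
    ext v
    change α (fun i => u.symm (u (v i))) = α v
    simp

end PullbackEquiv

section ModelProj

variable (n k : ℕ)

theorem isCompl_modelE (r : ℤ) :
    IsCompl (modelE n k r) (⨆ s, ⨆ (_ : s ≠ r), modelE n k s) := by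
  refine ⟨iSupIndep_modelE n k r, codisjoint_iff.mpr (top_le_iff.mp ?_)⟩
  rw [← iSup_modelE n k]
  refine iSup_le fun s => ?_
  rcases eq_or_ne s r with rfl | h
  · exact le_sup_left
  · exact le_sup_of_le_right (le_iSup₂_of_le (f := fun s (_ : s ≠ r) => modelE n k s) s h le_rfl)

/-- The projection of the model forms onto the component of weight `r`. -/
def modelProj (r : ℤ) : Module.End ℂ (AltForm (HSpace n) k) :=
  Submodule.projection _ _ (isCompl_modelE n k r)

end ModelProj

section Pointwise

variable {n : ℕ} {M : Type*} [TopologicalSpace M]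
  [ChartedSpace (EuclideanSpace ℝ (Fin (4 * n))) M] [IsManifold (𝓡 (4 * n)) ∞ M]
  (Q : SpGLStructure n M) {k : ℕ} {x : M}

theorem SpGLStructure.frames_nonempty (x : M) : (Q.frames x).Nonempty := by
  obtain ⟨U, -, hx, s, -, hs⟩ := Q.exists_section x
  exact ⟨s x, hs x hx⟩

/-- Two frames at `x` differ by an element of the group, which preserves `modelE`; so one frame
decides membership. -/
theorem SpGLStructure.mem_E_iff {u : HSpace n ≃L[ℝ] TangentSpace (𝓡 (4 * n)) x}
    (hu : u ∈ Q.frames x) {r : ℤ} {α : AltForm (TangentSpace (𝓡 (4 * n)) x) k} :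
    α ∈ Q.E k r x ↔ pullback (u : HSpace n →L[ℝ] TangentSpace (𝓡 (4 * n)) x) k α ∈
      modelE n k r := by
  have hle : Q.E k r x ≤
      (modelE n k r).comap (pullback (u : HSpace n →L[ℝ] TangentSpace (𝓡 (4 * n)) x) k) := by
    refine iSup₂_le fun w hw β hβ => ?_
    obtain ⟨g, hg, hgu⟩ := (Q.mem_frames_iff x w hw u).mp hu
    have := pullback_mem_modelE n k hg (Submodule.mem_comap.mp hβ)
    rw [hgu]
    exact this
  exact ⟨fun h => hle h, fun h => Submodule.mem_iSup_of_mem u (Submodule.mem_iSup_of_mem hu h)⟩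

theorem SpGLStructure.E_eq_map {u : HSpace n ≃L[ℝ] TangentSpace (𝓡 (4 * n)) x}
    (hu : u ∈ Q.frames x) (r : ℤ) :
    Q.E k r x = Submodule.orderIsoMapComap (pullbackEquiv u k).symm (modelE n k r) := by
  ext α
  rw [Q.mem_E_iff hu, Submodule.orderIsoMapComap_apply, Submodule.mem_map_equiv]
  rfl

theorem SpGLStructure.iSupIndep_E (k : ℕ) (x : M) : iSupIndep fun r : ℤ => Q.E k r x := by
  obtain ⟨u, hu⟩ := Q.frames_nonempty x
  simp only [Q.E_eq_map hu]
  exact (iSupIndep_modelE n k).map_orderIso _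

theorem SpGLStructure.iSup_E (k : ℕ) (x : M) : ⨆ r : ℤ, Q.E k r x = ⊤ := by
  obtain ⟨u, hu⟩ := Q.frames_nonempty x
  simp only [Q.E_eq_map hu]
  rw [← OrderIso.map_iSup, iSup_modelE, OrderIso.map_top]

theorem SpGLStructure.isInternal_E (k : ℕ) (x : M) :
    DirectSum.IsInternal fun r : ℤ => Q.E k r x :=
  (DirectSum.isInternal_submodule_iff_iSupIndep_and_iSup_eq_top _).mpr
    ⟨Q.iSupIndep_E k x, Q.iSup_E k x⟩

theorem SpGLStructure.E_eq_bot (x : M) {r : ℤ} (hr : ¬(0 ≤ r ∧ r ≤ k ∧ Even (k - r))) :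
    Q.E k r x = ⊥ := by
  obtain ⟨u, hu⟩ := Q.frames_nonempty x
  rw [Q.E_eq_map hu, modelE_eq_bot n k hr, OrderIso.map_bot]

theorem SpGLStructure.isCompl_E (k : ℕ) (r : ℤ) (x : M) :
    IsCompl (Q.E k r x) (⨆ s ∈ {s : ℤ | s ≠ r}, Q.E k s x) := by
  refine ⟨Q.iSupIndep_E k x r, codisjoint_iff.mpr (top_le_iff.mp ?_)⟩
  rw [← Q.iSup_E k x]
  refine iSup_le fun s => ?_
  rcases eq_or_ne s r with rfl | h
  · exact le_sup_left
  · exact le_sup_of_le_right (le_iSup₂_of_le (f := fun s (_ : s ≠ r) => Q.E k s x) s h le_rfl)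

theorem SpGLStructure.proj_mem (r : ℤ) (α : AltForm (TangentSpace (𝓡 (4 * n)) x) k) :
    Q.proj k r x α ∈ Q.E k r x := by
  rw [SpGLStructure.proj, dif_pos (Q.isCompl_E k r x)]
  exact Submodule.projection_apply_mem _ _

theorem SpGLStructure.proj_of_mem {r : ℤ} {α : AltForm (TangentSpace (𝓡 (4 * n)) x) k}
    (hα : α ∈ Q.E k r x) : Q.proj k r x α = α := by
  rw [SpGLStructure.proj, dif_pos (Q.isCompl_E k r x)]
  exact Submodule.projection_apply_of_mem_left _ hα

theorem SpGLStructure.proj_of_mem_ne {r s : ℤ} (hrs : s ≠ r)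
    {α : AltForm (TangentSpace (𝓡 (4 * n)) x) k} (hα : α ∈ Q.E k s x) : Q.proj k r x α = 0 := by
  rw [SpGLStructure.proj, dif_pos (Q.isCompl_E k r x)]
  exact Submodule.projection_apply_of_mem_right _
    ((le_iSup₂_of_le (f := fun s (_ : s ∈ {s : ℤ | s ≠ r}) => Q.E k s x) s hrs le_rfl) hα)

theorem SpGLStructure.form_induction {motive : AltForm (TangentSpace (𝓡 (4 * n)) x) k → Prop}
    (mem : ∀ r, ∀ α ∈ Q.E k r x, motive α)
    (add : ∀ α β, motive α → motive β → motive (α + β))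
    (α : AltForm (TangentSpace (𝓡 (4 * n)) x) k) : motive α := by
  have hα : α ∈ ⨆ r : ℤ, Q.E k r x := by rw [Q.iSup_E]; trivial
  exact Submodule.iSup_induction _ (motive := motive) hα mem (mem 0 0 (zero_mem _)) add

/-- In a frame the projection becomes the constant map `modelProj`, which is what makes components
of smooth forms smooth. -/
theorem SpGLStructure.proj_eq {u : HSpace n ≃L[ℝ] TangentSpace (𝓡 (4 * n)) x}
    (hu : u ∈ Q.frames x) (r : ℤ) (α : AltForm (TangentSpace (𝓡 (4 * n)) x) k) :
    Q.proj k r x α = (pullbackEquiv u k).symm (modelProj n k r (pullbackEquiv u k α)) := by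
  rw [LinearEquiv.eq_symm_apply]
  induction α using Q.form_induction with
  | mem s β hβ =>
    have hβ' := (Q.mem_E_iff hu).mp hβ
    rcases eq_or_ne s r with rfl | h
    · rw [Q.proj_of_mem hβ]
      exact (Submodule.projection_apply_of_mem_left _ hβ').symm
    · rw [Q.proj_of_mem_ne h hβ, map_zero]
      exact (Submodule.projection_apply_of_mem_right (isCompl_modelE n k r)
        ((le_iSup₂_of_le (f := fun s (_ : s ≠ r) => modelE n k s) s h le_rfl) hβ')).symm
  | add β γ hβ hγ =>
    simp only [map_add, hβ, hγ]

/-- A form is the sum of its components. -/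
theorem SpGLStructure.sum_proj (α : AltForm (TangentSpace (𝓡 (4 * n)) x) k) :
    ∑ r ∈ Finset.range (k + 1), Q.proj k r x α = α := by
  induction α using Q.form_induction with
  | mem s β hβ =>
    by_cases hs : 0 ≤ s ∧ s ≤ k ∧ Even (k - s)
    · obtain ⟨m, rfl⟩ := Int.eq_ofNat_of_zero_le hs.1
      rw [Finset.sum_eq_single m (fun r _ hr => Q.proj_of_mem_ne (by exact_mod_cast hr.symm) hβ)
        (fun h => absurd (Finset.mem_range.mpr (by lia)) h), Q.proj_of_mem hβ]
    · rw [Q.E_eq_bot x hs, Submodule.mem_bot] at hβ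
      simp [hβ]
  | add β γ hβ hγ =>
    simp only [map_add, Finset.sum_add_distrib, hβ, hγ]

theorem SpGLStructure.conjForm_mem_E {r : ℤ} {α : AltForm (TangentSpace (𝓡 (4 * n)) x) k}
    (hα : α ∈ Q.E k r x) : conjForm α ∈ Q.E k r x := by
  obtain ⟨u, hu⟩ := Q.frames_nonempty x
  rw [Q.mem_E_iff hu] at hα ⊢
  rw [pullback_conjForm]
  exact conjForm_mem_modelE hα

theorem SpGLStructure.proj_conjForm (r : ℤ) (α : AltForm (TangentSpace (𝓡 (4 * n)) x) k) :
    Q.proj k r x (conjForm α) = conjForm (Q.proj k r x α) := by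
  induction α using Q.form_induction with
  | mem s β hβ =>
    rcases eq_or_ne s r with rfl | h
    · rw [Q.proj_of_mem hβ, Q.proj_of_mem (Q.conjForm_mem_E hβ)]
    · rw [Q.proj_of_mem_ne h hβ, Q.proj_of_mem_ne h (Q.conjForm_mem_E hβ), conjForm_zero]
  | add β γ hβ hγ =>
    simp only [map_add, conjForm_add, hβ, hγ]

end Pointwise

/-! ### Smooth families of forms -/

section Smooth

variable {X V W : Type*} [NormedAddCommGroup X] [NormedSpace ℝ X]
  [NormedAddCommGroup V] [NormedSpace ℝ V] [NormedAddCommGroup W] [NormedSpace ℝ W]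
  {k : ℕ} {m : WithTop ℕ∞} {s : Set X}

/-- A family of forms is smooth if its values on all vectors are. -/
theorem contDiffOn_altForm [FiniteDimensional ℝ V] {f : X → AltForm V k}
    (hf : ∀ v, ContDiffOn ℝ m (fun y => f y v) s) : ContDiffOn ℝ m f s := by
  let b := Module.finBasis ℝ V
  let ev : AltForm V k →ₗ[ℝ] ((Fin k → Fin (Module.finrank ℝ V)) → ℂ) :=
    { toFun := fun α i => α fun j => b (i j)
      map_add' := fun _ _ => rfl
      map_smul' := fun _ _ => rfl }
  have hinj : ev.ker = ⊥ := by
    refine LinearMap.ker_eq_bot.mpr fun α β h => ?_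
    exact ContinuousAlternatingMap.toAlternatingMap_injective
      (Module.Basis.ext_alternating b fun i _ => congrFun h i)
  obtain ⟨g, hg⟩ := ev.exists_leftInverse_of_injective hinj
  have hfg : f = (LinearMap.toContinuousLinearMap g) ∘ fun y => ev (f y) := by
    funext y
    exact (LinearMap.congr_fun hg (f y)).symm
  rw [hfg]
  exact (LinearMap.toContinuousLinearMap g).contDiff.comp_contDiffOn
    (contDiffOn_pi.mpr fun i => hf _)

/-- Pullback is linear in the form and continuous multilinear in `k` copies of the map. -/
theorem contDiffOn_pullback [FiniteDimensional ℝ V] {f : X → AltForm W k} {g : X → V →L[ℝ] W}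
    (hf : ContDiffOn ℝ m f s) (hg : ContDiffOn ℝ m g s) :
    ContDiffOn ℝ m (fun y => pullback (g y) k (f y)) s := by
  refine contDiffOn_altForm fun v => ?_
  have h1 : ContDiffOn ℝ m (fun y => (f y).toContinuousMultilinearMap) s :=
    (ContinuousAlternatingMap.toContinuousMultilinearMapCLM (𝕜 := ℝ) (E := W) (F := ℂ)
      (ι := Fin k) ℝ).contDiff.comp_contDiffOn hf
  have h2 : ContDiffOn ℝ m (fun y =>
      ContinuousMultilinearMap.compContinuousLinearMapContinuousMultilinear ℝ
        (fun _ : Fin k => V) (fun _ => W) ℂ fun _ => g y) s :=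
    (ContinuousMultilinearMap.contDiff _).comp_contDiffOn (contDiffOn_pi.mpr fun _ => hg)
  exact (ContinuousMultilinearMap.apply ℝ (fun _ : Fin k => V) ℂ v).contDiff.comp_contDiffOn
    (h2.clm_apply h1)

theorem contDiffOn_inverse [CompleteSpace V] {g : X → V →L[ℝ] W} (hg : ContDiffOn ℝ m g s)
    (hinv : ∀ y ∈ s, (g y).IsInvertible) : ContDiffOn ℝ m (fun y => (g y).inverse) s := by
  intro y hy
  obtain ⟨e, he⟩ := hinv y hy
  have := contDiffAt_map_inverse (n := m) e
  rw [he] at this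
  exact this.comp_contDiffWithinAt y (hg y hy)

end Smooth

/-! ### The exterior derivative in a moving frame -/

section MovingFrame

open ContinuousAlternatingMap

variable {V : Type*} [NormedAddCommGroup V] [NormedSpace ℝ V] {n k : ℕ}

/-- Otherwise some functional vanishes on `S` but not at `f' v`; composed with `f` it is locally
zero, so its derivative is zero. -/
theorem hasFDerivAt_mem_submodule {X : Type*} [NormedAddCommGroup X] [NormedSpace ℝ X]
    {F : Type*} [NormedAddCommGroup F] [NormedSpace ℝ F] [FiniteDimensional ℝ F]
    {f : X → F} {f' : X →L[ℝ] F} {y : X} (hf : HasFDerivAt f f' y) (S : Submodule ℝ F)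
    (hS : ∀ᶠ z in nhds y, f z ∈ S) (v : X) : f' v ∈ S := by
  by_contra hv
  obtain ⟨φ, hφ, hle⟩ := S.exists_le_ker_of_notMem hv
  have h1 : HasFDerivAt (fun z => φ.toContinuousLinearMap (f z))
      (φ.toContinuousLinearMap ∘L f') y := φ.toContinuousLinearMap.hasFDerivAt.comp y hf
  have h0 : (fun z => φ.toContinuousLinearMap (f z)) =ᶠ[nhds y] fun _ => (0 : ℝ) := by
    filter_upwards [hS] with z hz using hle hz
  have := h1.unique ((hasFDerivAt_const (0 : ℝ) y).congr_of_eventuallyEq h0)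
  exact hφ (DFunLike.congr_fun this v)

/-- If the pullback of `σ` by the moving frame `S` takes values in `E_{k,r}`, and the frame is
parallel up to the Lie algebra of `Sp(1)GL(n,ℍ)` for a torsion-free connection, with connection
form `T`, then the exterior derivative of `σ` lies in `E_{k+1,r+1} ⊕ E_{k+1,r-1}`. -/
theorem pullback_extDeriv_mem {σ : V → AltForm V k} {S : V → HSpace n →L[ℝ] V} {y : V} {r : ℤ}
    (hσ : DifferentiableAt ℝ σ y) (hS : DifferentiableAt ℝ S y)
    (hmem : ∀ᶠ z in nhds y, pullback (S z) k (σ z) ∈ modelE n k r)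
    (T : HSpace n →L[ℝ] HSpace n →L[ℝ] HSpace n) (hT : ∀ w, MemLieSpGL n (T w))
    (htors : ∀ v w, fderiv ℝ S y (S y w) v - S y (T w v) =
      fderiv ℝ S y (S y v) w - S y (T v w)) :
    pullback (S y) (k + 1) (extDeriv σ y) ∈
      modelE n (k + 1) (r + 1) ⊔ modelE n (k + 1) (r - 1) := by
  set g := S y with hg
  have hd := hσ.hasFDerivAt.continuousAlternatingMapCompContinuousLinearMap hS.hasFDerivAt
  have hdmem (v : V) := hasFDerivAt_mem_submodule hd ((modelE n k r).restrictScalars ℝ) hmem v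
  -- `P` is the covariant derivative of `σ` in the frame: the derivative of the pulled-back form
  -- plus the action of the connection form on it. Both terms stay in `E_{k,r}`.
  set P : HSpace n →L[ℝ] AltForm (HSpace n) k :=
    (compContinuousLinearMapCLM g ∘L fderiv ℝ σ y +
        (σ y).fderivCompContinuousLinearMap g ∘L fderiv ℝ S y) ∘L g +
      -((σ y).fderivCompContinuousLinearMap g ∘L
        (ContinuousLinearMap.compL ℝ (HSpace n) (HSpace n) V g ∘L T)) with hP
  -- `h` compares the flat derivative of the frame with the connection; `htors` says that it is
  -- symmetric.
  set h : HSpace n →L[ℝ] HSpace n →L[ℝ] V :=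
    fderiv ℝ S y ∘L g - ContinuousLinearMap.compL ℝ (HSpace n) (HSpace n) V g ∘L T with hh
  have hPmem (w : HSpace n) : P w ∈ modelE n k r := by
    refine add_mem (hdmem (g w)) ?_
    have hmem_y : pullback g k (σ y) ∈ modelE n k r := hmem.self_of_nhds
    have := lieAct_mem_modelE n k (hT w) hmem_y
    convert this using 1
    ext v
    rw [lieAct_apply]
    change -((σ y).fderivCompContinuousLinearMap g (g ∘L T w)) v = _
    rw [fderivCompContinuousLinearMap_apply]
    congr 1
    refine Finset.sum_congr rfl fun i _ => ?_
    change _ = σ y fun j => g (Function.update v i (T w (v i)) j)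
    congr 1
    funext j
    rcases eq_or_ne j i with rfl | hj
    · simp
    · simp [hj]
  have hsplit : P = compContinuousLinearMapCLM g ∘L fderiv ℝ σ y ∘L g +
      (σ y).fderivCompContinuousLinearMap g ∘L h := by
    ext1 w
    simp only [hP, hh, _root_.add_apply, _root_.sub_apply, _root_.neg_apply,
      ContinuousLinearMap.comp_apply, _root_.map_sub]
    abel
  have hpull : pullback g (k + 1) (extDeriv σ y) =
      alternatizeUncurryFin (compContinuousLinearMapCLM g ∘L fderiv ℝ σ y ∘L g) := by
    ext v
    change (alternatizeUncurryFin (fderiv ℝ σ y)).compContinuousLinearMap g v = _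
    simp +unfoldPartialApp [alternatizeUncurryFin_apply, Fin.removeNth,
      Function.comp_def]
  -- Skew-symmetrization kills the term through the symmetric `h`, so `P` skew-symmetrizes to the
  -- pullback of `dσ`.
  have hzero : alternatizeUncurryFin ((σ y).fderivCompContinuousLinearMap g ∘L h) = 0 :=
    alternatizeUncurryFin_fderivCompContinuousLinearMap_eq_zero _ _ fun v w => htors w v
  have := alternatizeUncurryFin_mem_modelE n k hPmem
  rwa [hsplit, alternatizeUncurryFin_add, hzero, add_zero, ← hpull] at this

end MovingFrame

/-! ### The exterior derivative in charts -/

section Charts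

open ContinuousAlternatingMap Topology

variable {n : ℕ} {M : Type*} [TopologicalSpace M]
  [ChartedSpace (EuclideanSpace ℝ (Fin (4 * n))) M] {k : ℕ}

theorem minSmoothness_two_le_infty : minSmoothness ℝ 2 ≤ ∞ := by
  rw [minSmoothness_of_isRCLikeNormedField]
  exact WithTop.coe_le_coe.mpr (le_top : (2 : ℕ∞) ≤ ⊤)

theorem chartRep_apply (η : DForm n M k) (x₀ : M) (y : EuclideanSpace ℝ (Fin (4 * n))) :
    chartRep η x₀ y = pullback (mfderiv 𝓘(ℝ, EuclideanSpace ℝ (Fin (4 * n))) (𝓡 (4 * n))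
      (extChartAt (𝓡 (4 * n)) x₀).symm y) k (η ((extChartAt (𝓡 (4 * n)) x₀).symm y)) := rfl

theorem chartRep_add (η θ : DForm n M k) (x₀ : M) :
    chartRep (η + θ) x₀ = chartRep η x₀ + chartRep θ x₀ := rfl

theorem chartRep_smul (c : ℂ) (η : DForm n M k) (x₀ : M) :
    chartRep (c • η) x₀ = c • chartRep η x₀ := rfl

theorem IsSmoothForm.add {η θ : DForm n M k} (hη : IsSmoothForm η) (hθ : IsSmoothForm θ) :
    IsSmoothForm (η + θ) := fun x₀ => (hη x₀).add (hθ x₀)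

theorem IsSmoothForm.smul (c : ℂ) {η : DForm n M k} (hη : IsSmoothForm η) :
    IsSmoothForm (c • η) := fun x₀ => (hη x₀).const_smul c

theorem isSmoothForm_zero : IsSmoothForm (0 : DForm n M k) := fun _ =>
  contDiffOn_const (c := (0 : AltForm (EuclideanSpace ℝ (Fin (4 * n))) k))

theorem IsSmoothForm.sum {ι : Type*} (t : Finset ι) {η : ι → DForm n M k}
    (hη : ∀ i ∈ t, IsSmoothForm (η i)) : IsSmoothForm (∑ i ∈ t, η i) :=
  Finset.sum_induction _ _ (fun _ _ => IsSmoothForm.add) isSmoothForm_zero hη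

/-- The complex conjugate of a differential form. -/
def conjD (η : DForm n M k) : DForm n M k := fun x => conjForm (η x)

theorem conjD_eq_self_iff (η : DForm n M k) : conjD η = η ↔ IsRealForm η := by
  simp only [funext_iff, conjD, conjForm_eq_self_iff, IsRealForm]

/-- Complex conjugation of forms as a continuous real-linear map. -/
def conjCLM (V : Type*) [NormedAddCommGroup V] [NormedSpace ℝ V] (k : ℕ) :
    AltForm V k →L[ℝ] AltForm V k :=
  ContinuousLinearMap.compContinuousAlternatingMapCLM ℝ V ℂ ℂ (Fin k)
    (Complex.conjCLE : ℂ →L[ℝ] ℂ)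

theorem extDeriv_complex_smul {V : Type*} [NormedAddCommGroup V] [NormedSpace ℝ V] (c : ℂ)
    (σ : V → AltForm V k) (y : V) : extDeriv (c • σ) y = c • extDeriv σ y := by
  have h : fderiv ℝ (c • σ) y = c • fderiv ℝ σ y := congrFun (fderiv_const_smul_field (f := σ) c) y
  exact (congrArg alternatizeUncurryFin h).trans (alternatizeUncurryFin_smul c _)

theorem extDeriv_conjCLM {V : Type*} [NormedAddCommGroup V] [NormedSpace ℝ V]
    {σ : V → AltForm V k} {y : V} (hσ : DifferentiableAt ℝ σ y) :
    extDeriv (fun z => conjCLM V k (σ z)) y = conjCLM V (k + 1) (extDeriv σ y) := by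
  have h : fderiv ℝ (fun z => conjCLM V k (σ z)) y = conjCLM V k ∘L fderiv ℝ σ y :=
    ((conjCLM V k).hasFDerivAt.comp y hσ.hasFDerivAt).fderiv
  rw [extDeriv, h]
  ext v
  change alternatizeUncurryFin _ _ = starRingEnd ℂ (alternatizeUncurryFin _ _)
  rw [alternatizeUncurryFin_apply, alternatizeUncurryFin_apply, _root_.map_sum]
  refine Finset.sum_congr rfl fun i _ => ?_
  rw [map_zsmul]
  rfl

theorem extD_smul (c : ℂ) (η : DForm n M k) : extD (c • η) = c • extD η := by
  funext x
  rw [extD, chartRep_smul, extDeriv_complex_smul]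
  rfl

theorem extD_zero : extD (0 : DForm n M k) = 0 := by
  have := extD_smul (0 : ℂ) (0 : DForm n M k)
  rw [show (0 : ℂ) • (0 : DForm n M k) = 0 from
    funext fun x => smul_zero (A := AltForm (TangentSpace (𝓡 (4 * n)) x) k) (0 : ℂ)] at this
  rw [this]
  funext x
  exact zero_smul ℂ (extD (0 : DForm n M k) x)

theorem IsSmoothForm.contDiffAt {η : DForm n M k} (hη : IsSmoothForm η) {x₀ : M}
    {y : EuclideanSpace ℝ (Fin (4 * n))} (hy : y ∈ (extChartAt (𝓡 (4 * n)) x₀).target) :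
    ContDiffAt ℝ ∞ (chartRep η x₀) y :=
  (hη x₀).contDiffAt ((isOpen_extChartAt_target x₀).mem_nhds hy)

theorem IsSmoothForm.differentiableAt {η : DForm n M k} (hη : IsSmoothForm η) {x₀ : M}
    {y : EuclideanSpace ℝ (Fin (4 * n))} (hy : y ∈ (extChartAt (𝓡 (4 * n)) x₀).target) :
    DifferentiableAt ℝ (chartRep η x₀) y :=
  (hη.contDiffAt hy).differentiableAt (by simp)

theorem extD_add {η θ : DForm n M k} (hη : IsSmoothForm η) (hθ : IsSmoothForm θ) :
    extD (η + θ) = extD η + extD θ := by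
  funext x
  rw [extD, chartRep_add, extDeriv_add (hη.differentiableAt (mem_extChartAt_target x))
    (hθ.differentiableAt (mem_extChartAt_target x))]
  rfl

theorem extD_sum {ι : Type*} (t : Finset ι) {η : ι → DForm n M k}
    (hη : ∀ i ∈ t, IsSmoothForm (η i)) : extD (∑ i ∈ t, η i) = ∑ i ∈ t, extD (η i) := by
  classical
  induction t using Finset.induction_on with
  | empty => simp [extD_zero]
  | insert a t ha ih =>
    rw [Finset.sum_insert ha, Finset.sum_insert ha, extD_add (hη a (by simp))
      (IsSmoothForm.sum t fun i hi => hη i (by simp [hi])), ih fun i hi => hη i (by simp [hi])]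

theorem extD_conjD {η : DForm n M k} (hη : IsSmoothForm η) : extD (conjD η) = conjD (extD η) := by
  funext x
  have h : chartRep (conjD η) x = fun y => conjCLM _ k (chartRep η x y) := by
    funext y; ext v; rfl
  rw [extD, h, extDeriv_conjCLM (hη.differentiableAt (mem_extChartAt_target x))]
  rfl

variable [IsManifold (𝓡 (4 * n)) ∞ M]

theorem mfderiv_extChartAt_symm_comp {x₀ : M} {y : EuclideanSpace ℝ (Fin (4 * n))}
    (hy : y ∈ (extChartAt (𝓡 (4 * n)) x₀).target) :
    (mfderiv 𝓘(ℝ, EuclideanSpace ℝ (Fin (4 * n))) (𝓡 (4 * n))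
      (extChartAt (𝓡 (4 * n)) x₀).symm y) ∘L
      (mfderiv (𝓡 (4 * n)) 𝓘(ℝ, EuclideanSpace ℝ (Fin (4 * n))) (extChartAt (𝓡 (4 * n)) x₀)
        ((extChartAt (𝓡 (4 * n)) x₀).symm y)) = ContinuousLinearMap.id ℝ _ := by
  have : IsManifold (𝓡 (4 * n)) 1 M := IsManifold.of_le (n := ∞) (by simp)
  have h := mfderivWithin_extChartAt_symm_comp_mfderiv_extChartAt (I := 𝓡 (4 * n)) hy
  rwa [(𝓡 (4 * n)).range_eq_univ, mfderivWithin_univ] at h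

theorem mfderiv_extChartAt_comp_symm {x₀ : M} {y : EuclideanSpace ℝ (Fin (4 * n))}
    (hy : y ∈ (extChartAt (𝓡 (4 * n)) x₀).target) :
    (mfderiv (𝓡 (4 * n)) 𝓘(ℝ, EuclideanSpace ℝ (Fin (4 * n))) (extChartAt (𝓡 (4 * n)) x₀)
        ((extChartAt (𝓡 (4 * n)) x₀).symm y)) ∘L
      (mfderiv 𝓘(ℝ, EuclideanSpace ℝ (Fin (4 * n))) (𝓡 (4 * n))
      (extChartAt (𝓡 (4 * n)) x₀).symm y) = ContinuousLinearMap.id ℝ _ := by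
  have : IsManifold (𝓡 (4 * n)) 1 M := IsManifold.of_le (n := ∞) (by simp)
  have h := mfderiv_extChartAt_comp_mfderivWithin_extChartAt_symm (I := 𝓡 (4 * n)) hy
  rwa [(𝓡 (4 * n)).range_eq_univ, mfderivWithin_univ] at h

theorem isInvertible_mfderiv_extChartAt_symm {x₀ : M} {y : EuclideanSpace ℝ (Fin (4 * n))}
    (hy : y ∈ (extChartAt (𝓡 (4 * n)) x₀).target) :
    (mfderiv 𝓘(ℝ, EuclideanSpace ℝ (Fin (4 * n))) (𝓡 (4 * n))
      (extChartAt (𝓡 (4 * n)) x₀).symm y).IsInvertible :=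
  ContinuousLinearMap.IsInvertible.of_inverse (mfderiv_extChartAt_symm_comp hy)
    (mfderiv_extChartAt_comp_symm hy)

theorem contMDiffAt_extChartAt_symm {x₀ : M} {y : EuclideanSpace ℝ (Fin (4 * n))}
    (hy : y ∈ (extChartAt (𝓡 (4 * n)) x₀).target) :
    ContMDiffAt 𝓘(ℝ, EuclideanSpace ℝ (Fin (4 * n))) (𝓡 (4 * n)) ∞
      (extChartAt (𝓡 (4 * n)) x₀).symm y :=
  (contMDiffOn_extChartAt_symm x₀).contMDiffAt ((isOpen_extChartAt_target x₀).mem_nhds hy)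

/-- A form is recovered from its expression in a chart. -/
theorem pullback_chartRep (η : DForm n M k) {x₀ p : M}
    (hp : p ∈ (extChartAt (𝓡 (4 * n)) x₀).source) :
    pullback (mfderiv (𝓡 (4 * n)) 𝓘(ℝ, EuclideanSpace ℝ (Fin (4 * n)))
      (extChartAt (𝓡 (4 * n)) x₀) p) k (chartRep η x₀ (extChartAt (𝓡 (4 * n)) x₀ p)) = η p := by
  obtain ⟨y, hy, rfl⟩ : ∃ y ∈ (extChartAt (𝓡 (4 * n)) x₀).target,
      (extChartAt (𝓡 (4 * n)) x₀).symm y = p :=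
    ⟨_, (extChartAt (𝓡 (4 * n)) x₀).map_source hp, (extChartAt (𝓡 (4 * n)) x₀).left_inv hp⟩
  have h : chartRep η x₀ (extChartAt (𝓡 (4 * n)) x₀ ((extChartAt (𝓡 (4 * n)) x₀).symm y)) =
      chartRep η x₀ y := by rw [(extChartAt (𝓡 (4 * n)) x₀).right_inv hy]
  refine (congrArg (pullback (mfderiv (𝓡 (4 * n)) 𝓘(ℝ, EuclideanSpace ℝ (Fin (4 * n)))
      (extChartAt (𝓡 (4 * n)) x₀) ((extChartAt (𝓡 (4 * n)) x₀).symm y)) k) h).trans ?_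
  ext v
  change η _ (fun i => ((mfderiv 𝓘(ℝ, EuclideanSpace ℝ (Fin (4 * n))) (𝓡 (4 * n))
      (extChartAt (𝓡 (4 * n)) x₀).symm y) ∘L
      (mfderiv (𝓡 (4 * n)) 𝓘(ℝ, EuclideanSpace ℝ (Fin (4 * n))) (extChartAt (𝓡 (4 * n)) x₀)
        ((extChartAt (𝓡 (4 * n)) x₀).symm y))) (v i)) = _
  rw [mfderiv_extChartAt_symm_comp hy]
  rfl

/-- The exterior derivative may be computed in any chart. -/
theorem chartRep_extD {η : DForm n M k} (hη : IsSmoothForm η) {x₀ : M}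
    {y : EuclideanSpace ℝ (Fin (4 * n))} (hy : y ∈ (extChartAt (𝓡 (4 * n)) x₀).target) :
    chartRep (extD η) x₀ y = extDeriv (chartRep η x₀) y := by
  -- `extD` at `x'` uses the chart centred at `x'`; the two charts are compared by naturality of
  -- `extDeriv` under the transition map.
  set φ := extChartAt (𝓡 (4 * n)) x₀ with hφ
  set x' := φ.symm y with hx'
  set ψ := extChartAt (𝓡 (4 * n)) x' with hψ
  have hsrc : x' ∈ ψ.source := mem_extChartAt_source x'
  have hev : ∀ᶠ z in 𝓝 y, z ∈ φ.target ∧ φ.symm z ∈ ψ.source :=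
    ((isOpen_extChartAt_target x₀).eventually_mem hy).and
      ((continuousAt_extChartAt_symm'' hy).eventually
        ((isOpen_extChartAt_source x').eventually_mem hsrc))
  have hder {z : EuclideanSpace ℝ (Fin (4 * n))} (hz : z ∈ φ.target ∧ φ.symm z ∈ ψ.source) :
      fderiv ℝ (ψ ∘ φ.symm) z =
        (mfderiv (𝓡 (4 * n)) 𝓘(ℝ, EuclideanSpace ℝ (Fin (4 * n))) ψ (φ.symm z)) ∘L
          (mfderiv 𝓘(ℝ, EuclideanSpace ℝ (Fin (4 * n))) (𝓡 (4 * n)) φ.symm z) := by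
    rw [← mfderiv_eq_fderiv]
    refine mfderiv_comp z ?_ ((contMDiffAt_extChartAt_symm hz.1).mdifferentiableAt (by simp))
    have hchart := hz.2
    rw [hψ, extChartAt_source] at hchart
    exact (contMDiffAt_extChartAt' (n := ∞) hchart).mdifferentiableAt (by simp)
  have htrans : chartRep η x₀ =ᶠ[𝓝 y] fun z =>
      (chartRep η x' ((ψ ∘ φ.symm) z)).compContinuousLinearMap (fderiv ℝ (ψ ∘ φ.symm) z) := by
    filter_upwards [hev] with z hz
    rw [hder hz, chartRep_apply, ← pullback_chartRep η hz.2]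
    rfl
  have hτ : ContDiffAt ℝ ∞ (ψ ∘ φ.symm) y := by
    rw [← contMDiffAt_iff_contDiffAt]
    exact (contMDiffAt_extChartAt (n := ∞)).comp y (contMDiffAt_extChartAt_symm hy)
  have h := extDeriv_pullback (f := ψ ∘ φ.symm) (hη.differentiableAt (mem_extChartAt_target x'))
    hτ minSmoothness_two_le_infty
  rw [htrans.extDeriv_eq, h, hder hev.self_of_nhds]
  rfl

theorem IsSmoothForm.extD {η : DForm n M k} (hη : IsSmoothForm η) : IsSmoothForm (extD η) := by
  intro x₀
  refine ContDiffOn.congr ?_ fun y hy => chartRep_extD hη hy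
  exact (alternatizeUncurryFinCLM ℝ (EuclideanSpace ℝ (Fin (4 * n))) ℂ).contDiff.comp_contDiffOn
    ((hη x₀).fderiv_of_isOpen (isOpen_extChartAt_target x₀) (le_refl (∞ + 1)))

theorem extD_extD {η : DForm n M k} (hη : IsSmoothForm η) : extD (extD η) = 0 := by
  funext x
  -- The second derivative needs `extD η` near `x` in one fixed chart, not only at its centre.
  have h : chartRep (QuatDolbeault.extD η) x =ᶠ[𝓝 (extChartAt (𝓡 (4 * n)) x x)]
      extDeriv (chartRep η x) := by
    filter_upwards [(isOpen_extChartAt_target x).eventually_mem (mem_extChartAt_target x)]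
      with y hy using chartRep_extD hη hy
  rw [QuatDolbeault.extD, h.extDeriv_eq,
    extDeriv_extDeriv_apply (hη.contDiffAt (mem_extChartAt_target x))
      minSmoothness_two_le_infty]
  rfl

end Charts

/-! ### Frames in charts -/

section ChartFrame

open Topology VectorField

variable {n : ℕ} {M : Type*} [TopologicalSpace M]
  [ChartedSpace (EuclideanSpace ℝ (Fin (4 * n))) M] {k : ℕ}

/-- The expression of a frame field in the preferred chart at `x₀`. -/
def chartFrame (s : ∀ x : M, HSpace n ≃L[ℝ] TangentSpace (𝓡 (4 * n)) x) (x₀ : M)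
    (y : EuclideanSpace ℝ (Fin (4 * n))) : HSpace n →L[ℝ] EuclideanSpace ℝ (Fin (4 * n)) :=
  (mfderiv 𝓘(ℝ, EuclideanSpace ℝ (Fin (4 * n))) (𝓡 (4 * n))
    (extChartAt (𝓡 (4 * n)) x₀).symm y).inverse ∘L
      (s ((extChartAt (𝓡 (4 * n)) x₀).symm y) : HSpace n →L[ℝ] TangentSpace (𝓡 (4 * n)) _)

theorem isOpen_target_inter_preimage (x₀ : M) {U : Set M} (hU : IsOpen U) :
    IsOpen ((extChartAt (𝓡 (4 * n)) x₀).target ∩ (extChartAt (𝓡 (4 * n)) x₀).symm ⁻¹' U) :=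
  (continuousOn_extChartAt_symm x₀).isOpen_inter_preimage (isOpen_extChartAt_target x₀) hU

variable [IsManifold (𝓡 (4 * n)) ∞ M]
  {s : ∀ x : M, HSpace n ≃L[ℝ] TangentSpace (𝓡 (4 * n)) x} {U : Set M} {x₀ : M}
  {y : EuclideanSpace ℝ (Fin (4 * n))}

theorem chartFrame_eq_equiv (s : ∀ x : M, HSpace n ≃L[ℝ] TangentSpace (𝓡 (4 * n)) x)
    (hy : y ∈ (extChartAt (𝓡 (4 * n)) x₀).target) :
    ∃ e : HSpace n ≃L[ℝ] EuclideanSpace ℝ (Fin (4 * n)),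
      (e : HSpace n →L[ℝ] EuclideanSpace ℝ (Fin (4 * n))) = chartFrame s x₀ y ∧
      (e.symm : EuclideanSpace ℝ (Fin (4 * n)) →L[ℝ] HSpace n) =
        ((s ((extChartAt (𝓡 (4 * n)) x₀).symm y)).symm :
          TangentSpace (𝓡 (4 * n)) ((extChartAt (𝓡 (4 * n)) x₀).symm y) →L[ℝ] HSpace n) ∘L
        (mfderiv 𝓘(ℝ, EuclideanSpace ℝ (Fin (4 * n))) (𝓡 (4 * n))
          (extChartAt (𝓡 (4 * n)) x₀).symm y) := by
  obtain ⟨e, he⟩ := isInvertible_mfderiv_extChartAt_symm hy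
  refine ⟨(s ((extChartAt (𝓡 (4 * n)) x₀).symm y)).trans e.symm, ?_, ?_⟩
  · rw [chartFrame, ← he, ContinuousLinearMap.inverse_equiv]
    rfl
  · rw [← he]
    rfl

theorem isInvertible_chartFrame (s : ∀ x : M, HSpace n ≃L[ℝ] TangentSpace (𝓡 (4 * n)) x)
    (hy : y ∈ (extChartAt (𝓡 (4 * n)) x₀).target) : (chartFrame s x₀ y).IsInvertible :=
  let ⟨e, he, _⟩ := chartFrame_eq_equiv s hy
  ⟨e, he⟩

theorem inverse_chartFrame (s : ∀ x : M, HSpace n ≃L[ℝ] TangentSpace (𝓡 (4 * n)) x)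
    (hy : y ∈ (extChartAt (𝓡 (4 * n)) x₀).target) : (chartFrame s x₀ y).inverse =
      ((s ((extChartAt (𝓡 (4 * n)) x₀).symm y)).symm :
          TangentSpace (𝓡 (4 * n)) ((extChartAt (𝓡 (4 * n)) x₀).symm y) →L[ℝ] HSpace n) ∘L
        (mfderiv 𝓘(ℝ, EuclideanSpace ℝ (Fin (4 * n))) (𝓡 (4 * n))
          (extChartAt (𝓡 (4 * n)) x₀).symm y) := by
  obtain ⟨e, he, he'⟩ := chartFrame_eq_equiv s hy
  rw [← he, ContinuousLinearMap.inverse_equiv, he']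

theorem mfderiv_comp_chartFrame (s : ∀ x : M, HSpace n ≃L[ℝ] TangentSpace (𝓡 (4 * n)) x)
    (hy : y ∈ (extChartAt (𝓡 (4 * n)) x₀).target) :
    (mfderiv 𝓘(ℝ, EuclideanSpace ℝ (Fin (4 * n))) (𝓡 (4 * n))
      (extChartAt (𝓡 (4 * n)) x₀).symm y) ∘L chartFrame s x₀ y =
      (s ((extChartAt (𝓡 (4 * n)) x₀).symm y) : HSpace n →L[ℝ] TangentSpace (𝓡 (4 * n)) _) := by
  obtain ⟨e, he⟩ := isInvertible_mfderiv_extChartAt_symm hy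
  rw [chartFrame, ← he, ContinuousLinearMap.inverse_equiv]
  ext v
  exact e.apply_symm_apply _

theorem pullback_chartFrame (s : ∀ x : M, HSpace n ≃L[ℝ] TangentSpace (𝓡 (4 * n)) x)
    (hy : y ∈ (extChartAt (𝓡 (4 * n)) x₀).target) (η : DForm n M k) :
    pullback (chartFrame s x₀ y) k (chartRep η x₀ y) =
      pullback (s ((extChartAt (𝓡 (4 * n)) x₀).symm y) : HSpace n →L[ℝ] _) k
        (η ((extChartAt (𝓡 (4 * n)) x₀).symm y)) := by
  rw [← mfderiv_comp_chartFrame s hy]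
  rfl

/-- On a fixed vector this is the pullback of a smooth vector field by the inverse chart. -/
theorem contDiffOn_chartFrame (x₀ : M) (hU : IsOpen U) (hs : SmoothFrameOn s U) :
    ContDiffOn ℝ ∞ (chartFrame s x₀)
      ((extChartAt (𝓡 (4 * n)) x₀).target ∩ (extChartAt (𝓡 (4 * n)) x₀).symm ⁻¹' U) := by
  have : IsManifold (𝓡 (4 * n)) (∞ + 1) M := inferInstanceAs (IsManifold (𝓡 (4 * n)) ∞ M)
  refine contDiffOn_clm_apply.mpr fun v y hy => ContDiffAt.contDiffWithinAt ?_
  refine contMDiffAt_vectorSpace_iff_contDiffAt.mp ?_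
  exact ContMDiffAt.mpullback_vectorField_preimage (V := fun x => s x v) (n := ∞)
    ((hs v).contMDiffAt (hU.mem_nhds hy.2)) (contMDiffAt_extChartAt_symm hy.1)
    (isInvertible_mfderiv_extChartAt_symm hy.1) (le_refl (∞ + 1))

/-- The components of a smooth form are smooth. -/
theorem SpGLStructure.isSmoothForm_proj (Q : SpGLStructure n M) (r : ℤ) {η : DForm n M k}
    (hη : IsSmoothForm η) : IsSmoothForm fun x => Q.proj k r x (η x) := by
  intro x₀ y hy
  obtain ⟨U, hU, hyU, s, hs, hsQ⟩ := Q.exists_section ((extChartAt (𝓡 (4 * n)) x₀).symm y)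
  set O := (extChartAt (𝓡 (4 * n)) x₀).target ∩ (extChartAt (𝓡 (4 * n)) x₀).symm ⁻¹' U with hO
  have hO_open : IsOpen O := isOpen_target_inter_preimage x₀ hU
  have hframe : ContDiffOn ℝ ∞ (chartFrame s x₀) O := contDiffOn_chartFrame x₀ hU hs
  have hsmooth : ContDiffOn ℝ ∞ (fun z => pullback (chartFrame s x₀ z).inverse k
      (LinearMap.toContinuousLinearMap ((modelProj n k r).restrictScalars ℝ)
        (pullback (chartFrame s x₀ z) k (chartRep η x₀ z)))) O :=
    contDiffOn_pullback ((ContinuousLinearMap.contDiff _).comp_contDiffOn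
      (contDiffOn_pullback ((hη x₀).mono Set.inter_subset_left) hframe))
      (contDiffOn_inverse hframe fun z hz => isInvertible_chartFrame s hz.1)
  have heq : ∀ z ∈ O, chartRep (fun x => Q.proj k r x (η x)) x₀ z =
      pullback (chartFrame s x₀ z).inverse k
      (LinearMap.toContinuousLinearMap ((modelProj n k r).restrictScalars ℝ)
        (pullback (chartFrame s x₀ z) k (chartRep η x₀ z))) := by
    intro z hz
    rw [pullback_chartFrame s hz.1, inverse_chartFrame s hz.1, chartRep_apply,
      Q.proj_eq (hsQ _ hz.2)]
    rfl
  exact ((hsmooth.congr heq).contDiffAt (hO_open.mem_nhds ⟨hy, hyU⟩)).contDiffWithinAt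

theorem SpGLStructure.mem_E_sup_iff (Q : SpGLStructure n M) {x : M}
    {u : HSpace n ≃L[ℝ] TangentSpace (𝓡 (4 * n)) x} (hu : u ∈ Q.frames x) {a b : ℤ}
    {α : AltForm (TangentSpace (𝓡 (4 * n)) x) k} : α ∈ Q.E k a x ⊔ Q.E k b x ↔
      pullback (u : HSpace n →L[ℝ] TangentSpace (𝓡 (4 * n)) x) k α ∈
        modelE n k a ⊔ modelE n k b := by
  rw [Q.E_eq_map hu, Q.E_eq_map hu, ← OrderIso.map_sup, Submodule.orderIsoMapComap_apply,
    Submodule.mem_map_equiv]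
  rfl

/-- In a local frame of `Q` the connection form is Lie algebra valued, and vanishing torsion becomes
the symmetry hypothesis of `pullback_extDeriv_mem`. -/
theorem SpGLStructure.extD_mem_of_torsionFree (Q : SpGLStructure n M)
    (hQ : Q.AdmitsTorsionFreeConnection) {r : ℤ} {η : DForm n M k}
    (hη : Q.IsSmoothSection k r η) (hy : y ∈ (extChartAt (𝓡 (4 * n)) x₀).target) :
    extD η ((extChartAt (𝓡 (4 * n)) x₀).symm y) ∈
      Q.E (k + 1) (r + 1) ((extChartAt (𝓡 (4 * n)) x₀).symm y) ⊔
        Q.E (k + 1) (r - 1) ((extChartAt (𝓡 (4 * n)) x₀).symm y) := by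
  obtain ⟨cov, -, htor, hcomp⟩ := hQ
  set x' := (extChartAt (𝓡 (4 * n)) x₀).symm y with hx'
  obtain ⟨U, hU, hyU, s, hs, hsQ⟩ := Q.exists_section x'
  have hdiff : DifferentiableAt ℝ (chartFrame s x₀) y :=
    ((contDiffOn_chartFrame x₀ hU hs).contDiffAt
      ((isOpen_target_inter_preimage x₀ hU).mem_nhds ⟨hy, hyU⟩)).differentiableAt (by simp)
  have hM3 : IsManifold (𝓡 (4 * n)) (minSmoothness ℝ 3) M := by
    refine IsManifold.of_le (n := ∞) ?_
    rw [minSmoothness_of_isRCLikeNormedField]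
    exact WithTop.coe_le_coe.mpr (le_top : (3 : ℕ∞) ≤ ⊤)
  -- Compatibility yields an endomorphism for each direction separately; since `s x'` is injective,
  -- it depends linearly on the direction.
  choose Tf hTf hTfs using fun w => hcomp U s hU hs hsQ x' hyU (s x' w)
  let T : HSpace n →L[ℝ] HSpace n →L[ℝ] HSpace n := LinearMap.toContinuousLinearMap
    { toFun := Tf
      map_add' := fun w w' => by
        ext1 v
        apply (s x').injective
        rw [← hTfs, map_add, map_add, _root_.add_apply, map_add, ← hTfs, ← hTfs]
      map_smul' := fun c w => by
        ext1 v
        apply (s x').injective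
        rw [← hTfs, map_smul, map_smul, _root_.smul_apply, map_smul, ← hTfs]
        rfl }
  rw [Q.mem_E_sup_iff (hsQ x' hyU), ← pullback_chartFrame s hy, chartRep_extD hη.1 hy]
  refine pullback_extDeriv_mem (hη.1.differentiableAt hy) hdiff ?_ T hTf fun v w => ?_
  · filter_upwards [(isOpen_target_inter_preimage x₀ hU).eventually_mem ⟨hy, hyU⟩] with z hz
    rw [pullback_chartFrame s hz.1]
    exact (Q.mem_E_iff (hsQ _ hz.2)).mp (hη.2 _)
  · have hmd (v : HSpace n) : MDifferentiableAt (𝓡 (4 * n)) (𝓡 (4 * n)).tangent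
        (fun x => (⟨x, s x v⟩ : TangentBundle (𝓡 (4 * n)) M)) x' :=
      ((hs v).contMDiffAt (hU.mem_nhds hyU)).mdifferentiableAt (by simp)
    -- Zero torsion writes the bracket of two frame fields as `s (T v w - T w v)`; in the chart it
    -- is the flat Lie bracket.
    have h1 := cov.torsion_apply (hmd v) (hmd w)
    rw [htor, hTfs, hTfs] at h1
    have h2 : mlieBracket (𝓡 (4 * n)) (fun x => s x v) (fun x => s x w) x' =
        s x' (T v w - T w v) := by
      rw [map_sub]
      exact (sub_eq_zero.mp h1.symm).symm
    have h3 := mpullback_mlieBracket (I := 𝓘(ℝ, EuclideanSpace ℝ (Fin (4 * n))))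
      (f := (extChartAt (𝓡 (4 * n)) x₀).symm) (n := ∞) (hmd v) (hmd w)
      (contMDiffAt_extChartAt_symm hy) minSmoothness_two_le_infty
    have h4 : chartFrame s x₀ y (T v w - T w v) =
        lieBracket ℝ (fun z => chartFrame s x₀ z v) (fun z => chartFrame s x₀ z w) y := by
      rw [mpullback_apply, h2, ← mlieBracketWithin_univ,
        mlieBracketWithin_eq_lieBracketWithin] at h3
      rw [← lieBracketWithin_univ]
      exact h3
    have h5 (v : HSpace n) (u : EuclideanSpace ℝ (Fin (4 * n))) :
        fderiv ℝ (fun z => chartFrame s x₀ z v) y u = fderiv ℝ (chartFrame s x₀) y u v := by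
      rw [fderiv_clm_apply hdiff (differentiableAt_const v)]
      simp
    rw [lieBracket, h5, h5, map_sub] at h4
    linear_combination (norm := abel) h4

end ChartFrame

/-! ### The double complex -/

section DoubleComplex

variable {n : ℕ} {M : Type*} [TopologicalSpace M]
  [ChartedSpace (EuclideanSpace ℝ (Fin (4 * n))) M] [IsManifold (𝓡 (4 * n)) ∞ M]
  (Q : SpGLStructure n M) {k : ℕ}

/-- The component of weight `r` of a differential form. -/
def SpGLStructure.component (r : ℤ) (η : DForm n M k) : DForm n M k :=
  fun x => Q.proj k r x (η x)

/-- The part of the exterior derivative which shifts the weight by `e`. -/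
def SpGLStructure.shiftD (e : ℤ) (η : DForm n M k) : DForm n M (k + 1) :=
  ∑ r ∈ Finset.range (k + 1), Q.component (r + e) (extD (Q.component r η))

theorem SpGLStructure.D_eq_shiftD (η : DForm n M k) : Q.D η = Q.shiftD 1 η := rfl

/-- On integers `r - 1` is `r + (-1)` by definition, so `shiftD` treats both operators at once. -/
theorem SpGLStructure.Dbar_eq_shiftD (η : DForm n M k) : Q.Dbar η = Q.shiftD (-1) η := rfl

theorem SpGLStructure.component_add (r : ℤ) (η θ : DForm n M k) :
    Q.component r (η + θ) = Q.component r η + Q.component r θ :=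
  funext fun x => map_add (Q.proj k r x) (η x) (θ x)

theorem SpGLStructure.component_smul (r : ℤ) (c : ℂ) (η : DForm n M k) :
    Q.component r (c • η) = c • Q.component r η :=
  funext fun x => map_smul (Q.proj k r x) c (η x)

theorem SpGLStructure.component_zero (r : ℤ) : Q.component r (0 : DForm n M k) = 0 :=
  funext fun x => map_zero (Q.proj k r x)

theorem SpGLStructure.component_conjD (r : ℤ) (η : DForm n M k) :
    Q.component r (conjD η) = conjD (Q.component r η) :=
  funext fun x => Q.proj_conjForm r (η x)

theorem SpGLStructure.isSmoothSection_component (r : ℤ) {η : DForm n M k} (hη : IsSmoothForm η) :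
    Q.IsSmoothSection k r (Q.component r η) :=
  ⟨Q.isSmoothForm_proj r hη, fun x => Q.proj_mem r (η x)⟩

theorem SpGLStructure.component_eq_self {r : ℤ} {η : DForm n M k} (hη : ∀ x, η x ∈ Q.E k r x) :
    Q.component r η = η :=
  funext fun x => Q.proj_of_mem (hη x)

theorem SpGLStructure.component_eq_zero {r s : ℤ} (hrs : s ≠ r) {η : DForm n M k}
    (hη : ∀ x, η x ∈ Q.E k s x) : Q.component r η = 0 :=
  funext fun x => Q.proj_of_mem_ne hrs (hη x)

theorem SpGLStructure.sum_component (η : DForm n M k) :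
    ∑ r ∈ Finset.range (k + 1), Q.component r η = η := by
  funext x
  rw [Finset.sum_apply]
  exact Q.sum_proj (η x)

theorem SpGLStructure.shiftD_add (e : ℤ) {η θ : DForm n M k} (hη : IsSmoothForm η)
    (hθ : IsSmoothForm θ) : Q.shiftD e (η + θ) = Q.shiftD e η + Q.shiftD e θ := by
  rw [shiftD, shiftD, shiftD, ← Finset.sum_add_distrib]
  refine Finset.sum_congr rfl fun r _ => ?_
  rw [component_add, extD_add (Q.isSmoothSection_component r hη).1
    (Q.isSmoothSection_component r hθ).1, component_add]

theorem SpGLStructure.shiftD_smul (e : ℤ) (c : ℂ) (η : DForm n M k) :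
    Q.shiftD e (c • η) = c • Q.shiftD e η := by
  funext x
  rw [shiftD, shiftD, Pi.smul_apply, Finset.sum_apply, Finset.sum_apply, Finset.smul_sum]
  refine Finset.sum_congr rfl fun r _ => ?_
  rw [component_smul, extD_smul, component_smul]
  rfl

theorem SpGLStructure.isSmoothForm_shiftD (e : ℤ) {η : DForm n M k} (hη : IsSmoothForm η) :
    IsSmoothForm (Q.shiftD e η) :=
  IsSmoothForm.sum _ fun r _ => Q.isSmoothForm_proj _ (Q.isSmoothSection_component r hη).1.extD

theorem SpGLStructure.shiftD_zero (e : ℤ) : Q.shiftD e (0 : DForm n M k) = 0 := by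
  rw [shiftD]
  refine Finset.sum_eq_zero fun r _ => ?_
  rw [component_zero, extD_zero, component_zero]

theorem SpGLStructure.shiftD_sum (e : ℤ) {ι : Type*} (t : Finset ι) {η : ι → DForm n M k}
    (hη : ∀ i ∈ t, IsSmoothForm (η i)) :
    Q.shiftD e (∑ i ∈ t, η i) = ∑ i ∈ t, Q.shiftD e (η i) := by
  classical
  induction t using Finset.induction_on with
  | empty => simp [shiftD_zero]
  | insert a t ha ih =>
    rw [Finset.sum_insert ha, Finset.sum_insert ha, Q.shiftD_add e (hη a (by simp))
      (IsSmoothForm.sum t fun i hi => hη i (by simp [hi])), ih fun i hi => hη i (by simp [hi])]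

theorem SpGLStructure.shiftD_conjD (e : ℤ) {η : DForm n M k} (hη : IsSmoothForm η) :
    Q.shiftD e (conjD η) = conjD (Q.shiftD e η) := by
  have h (r : ℕ) : Q.component (r + e) (extD (Q.component r (conjD η))) =
      conjD (Q.component (r + e) (extD (Q.component r η))) := by
    rw [component_conjD, extD_conjD (Q.isSmoothSection_component r hη).1, component_conjD]
  funext x
  have hsum : conjD (Q.shiftD e η) x =
      ∑ r ∈ Finset.range (k + 1), conjD (Q.component (r + e) (extD (Q.component r η))) x := by
    rw [conjD, shiftD, Finset.sum_apply]
    exact map_sum (conjCLM (EuclideanSpace ℝ (Fin (4 * n))) (k + 1)) _ _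
  rw [hsum, shiftD, Finset.sum_apply]
  exact Finset.sum_congr rfl fun r _ => congrFun (h r) x

/-- Only the summand of weight `r` survives; if `r` does not occur in degree `k`, the form is zero.
-/
theorem SpGLStructure.shiftD_section (e : ℤ) {r : ℤ} {η : DForm n M k}
    (hη : ∀ x, η x ∈ Q.E k r x) : Q.shiftD e η = Q.component (r + e) (extD η) := by
  by_cases hr : 0 ≤ r ∧ r ≤ k ∧ Even (k - r)
  · obtain ⟨m, rfl⟩ := Int.eq_ofNat_of_zero_le hr.1
    rw [shiftD, Finset.sum_eq_single m, Q.component_eq_self hη]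
    · intro s _ hs
      rw [Q.component_eq_zero (by exact_mod_cast hs.symm) hη, extD_zero, component_zero]
    · exact fun h => absurd (Finset.mem_range.mpr (by lia)) h
  · have h0 : η = 0 := funext fun x => by
      have := hη x
      rwa [Q.E_eq_bot x hr, Submodule.mem_bot] at this
    rw [h0, shiftD_zero, extD_zero, component_zero]

theorem SpGLStructure.upper_eq_shiftD {r : ℤ} {η : DForm n M k} (hη : ∀ x, η x ∈ Q.E k r x) :
    Q.upper k r η = Q.shiftD 1 η :=
  (Q.shiftD_section 1 hη).symm

theorem SpGLStructure.lower_eq_shiftD {r : ℤ} {η : DForm n M k} (hη : ∀ x, η x ∈ Q.E k r x) :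
    Q.lower k r η = Q.shiftD (-1) η :=
  (Q.shiftD_section (-1) hη).symm

theorem SpGLStructure.shiftD_add_smul (e : ℤ) (a b : ℂ) {η θ : DForm n M k} (hη : IsSmoothForm η)
    (hθ : IsSmoothForm θ) :
    Q.shiftD e (a • η + b • θ) = a • Q.shiftD e η + b • Q.shiftD e θ := by
  rw [Q.shiftD_add e (hη.smul a) (hθ.smul b), Q.shiftD_smul, Q.shiftD_smul]

theorem SpGLStructure.isSmoothSection_shiftD (e : ℤ) {r : ℤ} {η : DForm n M k}
    (hη : Q.IsSmoothSection k r η) : Q.IsSmoothSection (k + 1) (r + e) (Q.shiftD e η) := by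
  rw [Q.shiftD_section e hη.2]
  exact Q.isSmoothSection_component _ hη.1.extD

/-- The exterior derivative of a section of `E_{k,r}` is a section of
`E_{k+1,r+1} ⊕ E_{k+1,r-1}`. -/
theorem SpGLStructure.extD_mem (hn : 1 ≤ n) (hQ : 2 ≤ n → Q.AdmitsTorsionFreeConnection) {r : ℤ}
    {η : DForm n M k} (hη : Q.IsSmoothSection k r η) (x : M) :
    extD η x ∈ Q.E (k + 1) (r + 1) x ⊔ Q.E (k + 1) (r - 1) x := by
  rcases hn.eq_or_lt with rfl | hn
  -- For `n = 1` the two target components already exhaust `Λᵏ⁺¹`, unless there are no forms of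
  -- weight `r`.
  · by_cases hr : modelE 1 k r = ⊥
    · have h0 : η = 0 := funext fun x => by
        obtain ⟨u, hu⟩ := Q.frames_nonempty x
        have := hη.2 x
        rwa [Q.E_eq_map hu, hr, OrderIso.map_bot, Submodule.mem_bot] at this
      rw [h0, extD_zero]
      exact zero_mem _
    · obtain ⟨u, hu⟩ := Q.frames_nonempty x
      rw [Q.mem_E_sup_iff hu, modelE_one_sup_eq_top hr]
      trivial
  · have := Q.extD_mem_of_torsionFree (hQ hn) hη (mem_extChartAt_target (I := 𝓡 (4 * n)) x)
    rwa [extChartAt_to_inv] at this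

theorem SpGLStructure.proj_add_proj {r s : ℤ} (hrs : r ≠ s) {x : M}
    {α : AltForm (TangentSpace (𝓡 (4 * n)) x) k} (hα : α ∈ Q.E k r x ⊔ Q.E k s x) :
    Q.proj k r x α + Q.proj k s x α = α := by
  obtain ⟨β, hβ, γ, hγ, rfl⟩ := Submodule.mem_sup.mp hα
  rw [map_add, map_add, Q.proj_of_mem hβ, Q.proj_of_mem hγ, Q.proj_of_mem_ne hrs hβ,
    Q.proj_of_mem_ne hrs.symm hγ, add_zero, zero_add]

theorem SpGLStructure.extD_section (hn : 1 ≤ n) (hQ : 2 ≤ n → Q.AdmitsTorsionFreeConnection)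
    {r : ℤ} {η : DForm n M k} (hη : Q.IsSmoothSection k r η) :
    extD η = Q.shiftD 1 η + Q.shiftD (-1) η := by
  rw [Q.shiftD_section 1 hη.2, Q.shiftD_section (-1) hη.2]
  funext x
  exact (Q.proj_add_proj (by lia) (Q.extD_mem hn hQ hη x)).symm

theorem SpGLStructure.extD_eq (hn : 1 ≤ n) (hQ : 2 ≤ n → Q.AdmitsTorsionFreeConnection)
    {η : DForm n M k} (hη : IsSmoothForm η) : extD η = Q.shiftD 1 η + Q.shiftD (-1) η := by
  have hc (r : ℕ) (_ : r ∈ Finset.range (k + 1)) : IsSmoothForm (Q.component r η) :=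
    (Q.isSmoothSection_component r hη).1
  rw [← Q.sum_component η, extD_sum _ hc, Q.shiftD_sum 1 _ hc, Q.shiftD_sum (-1) _ hc,
    ← Finset.sum_add_distrib]
  exact Finset.sum_congr rfl fun r _ => Q.extD_section hn hQ (Q.isSmoothSection_component r hη)

/-- By `d² = 0` the four composites sum to zero; their weights are `r + 2`, `r`, `r`, `r - 2`, so
taking components separates them. -/
theorem SpGLStructure.shiftD_shiftD_section (hn : 1 ≤ n)
    (hQ : 2 ≤ n → Q.AdmitsTorsionFreeConnection) {r : ℤ} {η : DForm n M k}
    (hη : Q.IsSmoothSection k r η) :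
    Q.shiftD 1 (Q.shiftD 1 η) = 0 ∧
      Q.shiftD 1 (Q.shiftD (-1) η) + Q.shiftD (-1) (Q.shiftD 1 η) = 0 ∧
      Q.shiftD (-1) (Q.shiftD (-1) η) = 0 := by
  have hu := Q.isSmoothSection_shiftD 1 hη
  have hl := Q.isSmoothSection_shiftD (-1) hη
  have huu := (Q.isSmoothSection_shiftD 1 hu).2
  have hul := (Q.isSmoothSection_shiftD 1 hl).2
  have hlu := (Q.isSmoothSection_shiftD (-1) hu).2
  have hll := (Q.isSmoothSection_shiftD (-1) hl).2
  have hd : Q.shiftD 1 (Q.shiftD 1 η) + Q.shiftD (-1) (Q.shiftD 1 η) +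
      (Q.shiftD 1 (Q.shiftD (-1) η) + Q.shiftD (-1) (Q.shiftD (-1) η)) = 0 := by
    rw [← Q.extD_section hn hQ hu, ← Q.extD_section hn hQ hl, ← extD_add hu.1 hl.1,
      ← Q.extD_section hn hQ hη, extD_extD hη.1]
  generalize Q.shiftD 1 (Q.shiftD 1 η) = a at *
  generalize Q.shiftD 1 (Q.shiftD (-1) η) = b at *
  generalize Q.shiftD (-1) (Q.shiftD 1 η) = c at *
  generalize Q.shiftD (-1) (Q.shiftD (-1) η) = d at *
  rw [show r + 1 + 1 = r + 2 by ring] at huu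
  rw [show r + -1 + 1 = r by ring] at hul
  rw [show r + 1 + -1 = r by ring] at hlu
  rw [show r + -1 + -1 = r - 2 by ring] at hll
  have h (s : ℤ) : Q.component s a + Q.component s c + (Q.component s b + Q.component s d) = 0 := by
    rw [← component_add, ← component_add, ← component_add, hd, component_zero]
  refine ⟨?_, ?_, ?_⟩
  · have := h (r + 2)
    rwa [Q.component_eq_self huu, Q.component_eq_zero (by lia) hul,
      Q.component_eq_zero (by lia) hlu, Q.component_eq_zero (by lia) hll, add_zero, add_zero,
      add_zero] at this
  · have := h r
    rwa [Q.component_eq_zero (by lia) huu, Q.component_eq_self hul, Q.component_eq_self hlu,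
      Q.component_eq_zero (by lia) hll, add_zero, zero_add, add_comm c b] at this
  · have := h (r - 2)
    rwa [Q.component_eq_zero (by lia) huu, Q.component_eq_zero (by lia) hul,
      Q.component_eq_zero (by lia) hlu, Q.component_eq_self hll, add_zero, zero_add,
      zero_add] at this

theorem SpGLStructure.shiftD_shiftD (hn : 1 ≤ n) (hQ : 2 ≤ n → Q.AdmitsTorsionFreeConnection)
    {η : DForm n M k} (hη : IsSmoothForm η) :
    Q.shiftD 1 (Q.shiftD 1 η) = 0 ∧
      Q.shiftD 1 (Q.shiftD (-1) η) + Q.shiftD (-1) (Q.shiftD 1 η) = 0 ∧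
      Q.shiftD (-1) (Q.shiftD (-1) η) = 0 := by
  have hc (r : ℕ) (_ : r ∈ Finset.range (k + 1)) : IsSmoothForm (Q.component r η) :=
    (Q.isSmoothSection_component r hη).1
  have hsum (e f : ℤ) : Q.shiftD f (Q.shiftD e η) =
      ∑ r ∈ Finset.range (k + 1), Q.shiftD f (Q.shiftD e (Q.component r η)) := by
    conv_lhs => rw [← Q.sum_component η, Q.shiftD_sum e _ hc,
      Q.shiftD_sum f _ fun r hr => Q.isSmoothForm_shiftD e (hc r hr)]
  have h (r : ℕ) := Q.shiftD_shiftD_section hn hQ (Q.isSmoothSection_component r hη)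
  rw [hsum, hsum, hsum, hsum, ← Finset.sum_add_distrib]
  exact ⟨Finset.sum_eq_zero fun r _ => (h r).1, Finset.sum_eq_zero fun r _ => (h r).2.1,
    Finset.sum_eq_zero fun r _ => (h r).2.2⟩

/-- Real forms are those fixed by `conjD`, which commutes with `shiftD`. -/
theorem SpGLStructure.isRealForm_shiftD (e : ℤ) {η : DForm n M k} (hη : IsSmoothForm η)
    (hreal : IsRealForm η) : IsRealForm (Q.shiftD e η) := by
  rw [← conjD_eq_self_iff] at hreal ⊢
  rw [← Q.shiftD_conjD e hη, hreal]

end DoubleComplex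

end QuatDolbeault

end

open QuatDolbeault in
/-- On a quaternionic manifold, `d = 𝒟 + 𝒟̄` and `𝒟² = 𝒟𝒟̄ + 𝒟̄𝒟 = 𝒟̄² = 0`. For `n = 1` no
condition beyond the `Sp(1)GL(1,ℍ)`-structure (an oriented conformal structure) is imposed, so that
self-dual conformal 4-manifolds are covered. -/
theorem proposition4p5 (n : ℕ) (hn : 1 ≤ n) (M : Type*) [TopologicalSpace M] [T2Space M]
    [SecondCountableTopology M] [ChartedSpace (EuclideanSpace ℝ (Fin (4 * n))) M]
    [IsManifold (𝓡 (4 * n)) ∞ M] (Q : SpGLStructure n M)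
    (hQ : 2 ≤ n → Q.AdmitsTorsionFreeConnection) :
    -- the decomposition of forms which defines the projections
    (∀ (k : ℕ) (x : M), DirectSum.IsInternal fun r : ℤ => Q.E k r x) ∧
    -- on sections of `E_{k,r}` the operators are the components of `d` of higher and lower weight
    (∀ (k : ℕ) (r : ℤ) (η : DForm n M k), Q.IsSmoothSection k r η →
      Q.IsSmoothSection (k + 1) (r + 1) (Q.upper k r η) ∧
      Q.IsSmoothSection (k + 1) (r - 1) (Q.lower k r η) ∧
      extD η = Q.upper k r η + Q.lower k r η ∧
      Q.D η = Q.upper k r η ∧ Q.Dbar η = Q.lower k r η) ∧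
    -- the identities on all smooth forms
    (∀ (k : ℕ) (η : DForm n M k), IsSmoothForm η →
      IsSmoothForm (Q.D η) ∧ IsSmoothForm (Q.Dbar η) ∧
      extD η = Q.D η + Q.Dbar η ∧
      Q.D (Q.D η) = 0 ∧ Q.D (Q.Dbar η) + Q.Dbar (Q.D η) = 0 ∧ Q.Dbar (Q.Dbar η) = 0) ∧
    -- the operators are linear
    (∀ (k : ℕ) (a b : ℂ) (η θ : DForm n M k), IsSmoothForm η → IsSmoothForm θ →
      Q.D (a • η + b • θ) = a • Q.D η + b • Q.D θ ∧
      Q.Dbar (a • η + b • θ) = a • Q.Dbar η + b • Q.Dbar θ) ∧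
    -- the operators preserve real forms
    (∀ (k : ℕ) (η : DForm n M k), IsSmoothForm η → IsRealForm η →
      IsRealForm (Q.D η) ∧ IsRealForm (Q.Dbar η)) := by
  simp only [SpGLStructure.D_eq_shiftD, SpGLStructure.Dbar_eq_shiftD]
  refine ⟨fun k x => Q.isInternal_E k x, fun k r η hη => ?_, fun k η hη => ?_,
    fun k a b η θ hη hθ => ?_, fun k η hη hreal => ?_⟩
  · rw [Q.upper_eq_shiftD hη.2, Q.lower_eq_shiftD hη.2]
    exact ⟨Q.isSmoothSection_shiftD 1 hη, Q.isSmoothSection_shiftD (-1) hη,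
      Q.extD_section hn hQ hη, rfl, rfl⟩
  · exact ⟨Q.isSmoothForm_shiftD 1 hη, Q.isSmoothForm_shiftD (-1) hη, Q.extD_eq hn hQ hη,
      Q.shiftD_shiftD hn hQ hη⟩
  · exact ⟨Q.shiftD_add_smul 1 a b hη hθ, Q.shiftD_add_smul (-1) a b hη hθ⟩
  · exact ⟨Q.isRealForm_shiftD 1 hη hreal, Q.isRealForm_shiftD (-1) hη hreal⟩
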